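/- **Setting.** Let $N\ge 1$, $c\in\mathbb R^{N^2}$ (indexed by pairs $(i,j)\in[N]^2$), and let $A_\dagger\in\mathbb R^{(2N-1)\times N^2}$ be the matrix for which $A_\dagger\pi$ lists the first $N-1$ row sums and all $N$ column sums of $\pi=(\pi_{ij})$. For $r\in\mathbb R^N$ write $r_\dagger=(r_1,\dots,r_{N-1})$. Put $\Pi_\dagger(r,s)=\{\pi\ge 0: A_\dagger\pi=(r_\dagger,s)\}$ and let $\mathrm{ri}(\Delta_N)=\{r: r_i>0,\ \sum_i r_i=1\}$. A basis is a set $I\subseteq[N]^2$ of $2N-1$ column indices such that $A_{\dagger I}$ is invertible. Let $\pi(I,b)\in\mathbb R^{N^2}$ be the solution of $A_\dagger\pi=b$ vanishing outside $I$, and let $\lambda(I)$ be the solution of $\lambda^TA_{\dagger I}=c_I^T$. The basis $I$ is dual feasible if $\lambda(I)^TA_\dagger\le c^T$, and primal feasible for $b$ if $\pi(I,b)\ge 0$. Let $r,s\in\mathrm{ri}(\Delta_N)$ be such that $\min_{\pi\in\Pi_\dagger(r,s)}c^T\pi$ has a unique solution $\pi^\star$. Let $I_1,\dots,I_K$ enumerate,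 without repetition, the bases that are dual feasible and primal feasible for $(r_\dagger,s)$. Put $H_k=\{v\in\mathbb R^{2N-1}:\ \pi(I_k,v)_j\ge 0\text{ for all }j\in I_k\text{ with }\pi^\star_j=0\}$ and $H_{\mathcal K}=\bigcap_{k\in\mathcal K}H_k$. For $\alpha\in\mathbb R^{\mathcal K}$ let $\alpha\otimes\pi(I_{\mathcal K},v)=\sum_{k\in\mathcal K}\alpha_k\,\pi(I_k,v)$. Let $X_1,X_2,\dots$ be i.i.d. with law $r$ and, independently, $Y_1,Y_2,\dots$ i.i.d. with law $s$, with empirical measures $\hat r_n,\hat s_m$ of $X_1,\dots,X_n$ and $Y_1,\dots,Y_m$. Let $\hat\pi_{n,m}$ be any measurable choice of a minimiser of $c^T\pi$ over $\Pi_\dagger(\hat r_n,\hat s_m)$. Write $b=(r_\dagger,s)$, $b_{n,m}=(\hat r_{n\dagger},\hat s_m)$ and $\rho_{n,m}=\sqrt{nm/(n+m)}$. For $v\ge0$ with $\sum_i v_i\le 1$ let $\Sigma(v)$ be the matrix with diagonal entries $v_i(1-v_i)$ and off-diagonal entries $-v_iv_j$. Let the sample sizes $n,m\to\infty$ (along any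 sequence of pairs of positive integers) with $\frac{m}{n+m}\to\lambda\in(0,1)$, and let $G=G(r_\dagger,s)=(\sqrt\lambda\,G^1,\sqrt{1-\lambda}\,G^2)$, where $G^1\sim\mathcal N(0,\Sigma(r_\dagger))$ and $G^2\sim\mathcal N(0,\Sigma(s))$ are independent. **Theorem.** (1) For each nonempty $\mathcal K\subseteq[K]$ let $\alpha^{\mathcal K}_{n,m}$ be a random vector in the unit simplex of $\mathbb R^{\mathcal K}$ such that $\hat\pi_{n,m}=\alpha^{\mathcal K}_{n,m}\otimes\pi(I_{\mathcal K},b_{n,m})$ on the event that the dual feasible bases which are primal feasible for $b_{n,m}$ are exactly the $I_k$, $k\in\mathcal K$. Suppose that for each such $\mathcal K$ the pair $\big(\alpha^{\mathcal K}_{n,m},\rho_{n,m}(b_{n,m}-b)\big)$ converges jointly in distribution to $(\alpha^{\mathcal K},G)$, with $\alpha^{\mathcal K}$ a random vector in the unit simplex. Then $$\rho_{n,m}\,(\hat\pi_{n,m}-\pi^\star)\ \xrightarrow{D}\ \sum_{\emptyset\ne\mathcal K\subseteq[K]}\mathbf 1_{\{G\in H_{\mathcal K}\setminus\bigcup_{k\in[K]\setminus\mathcal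 K}H_k\}}\ \alpha^{\mathcal K}\otimes\pi(I_{\mathcal K},G).$$ (2) If $\lambda(I_j)\ne\lambda(I_k)$ for all $1\le j<k\le K$, then, without any assumption on weights, $$\rho_{n,m}\,(\hat\pi_{n,m}-\pi^\star)\ \xrightarrow{D}\ \sum_{k=1}^K\mathbf 1_{\{G\in H_k\setminus\bigcup_{j<k}H_j\}}\ \pi(I_k,G).$$ -/

import Mathlib

open MeasureTheory ProbabilityTheory Filter Topology
open scoped Matrix

noncomputable section

namespace LP

variable {ι κ : Type*} [Fintype ι] [Fintype κ]

/-- The feasible set `P(b) = {x | A x = b, x ≥ 0}`. -/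
def feasibleSet (A : Matrix ι κ ℝ) (b : ι → ℝ) : Set (κ → ℝ) :=
  {x | A *ᵥ x = b ∧ 0 ≤ x}

/-- The set `OPT(b)` of minimisers of `cᵀ x` over `P(b)`. -/
def optSet (A : Matrix ι κ ℝ) (c : κ → ℝ) (b : ι → ℝ) : Set (κ → ℝ) :=
  {x | x ∈ feasibleSet A b ∧ ∀ y ∈ feasibleSet A b, c ⬝ᵥ x ≤ c ⬝ᵥ y}

/-- A basis: as many column indices as there are rows, with linearly independent columns, i.e.
the square matrix `A_I` is invertible. -/
def IsBasis (A : Matrix ι κ ℝ) (I : Finset κ) : Prop :=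
  I.card = Fintype.card ι ∧ LinearIndependent ℝ (fun j : I => fun i => A i j)

open Classical in
/-- The primal basic solution `x(I, b) = Aug_I [A_I⁻¹ b]`: the solution of `A x = b` vanishing
outside `I`, unique when `I` is a basis (see `primalBasic_eq_iff`). The value `0` is only used
when there is no such solution, hence never for a basis. -/
def primalBasic (A : Matrix ι κ ℝ) (I : Finset κ) (b : ι → ℝ) : κ → ℝ :=
  if h : ∃ x : κ → ℝ, A *ᵥ x = b ∧ ∀ j ∉ I, x j = 0 then h.choose else 0

open Classical in
/-- The dual basic solution `λ(I) = A_I⁻ᵀ c_I`: the solution of `λᵀ A_I = c_I`, unique when `I` is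
a basis (see `dualBasic_eq_iff`). -/
def dualBasic (A : Matrix ι κ ℝ) (c : κ → ℝ) (I : Finset κ) : ι → ℝ :=
  if h : ∃ l : ι → ℝ, ∀ j ∈ I, (l ᵥ* A) j = c j then h.choose else 0

/-- A basis `I` is dual feasible when `λ(I)ᵀ A ≤ cᵀ`. -/
def IsDualFeasibleBasis (A : Matrix ι κ ℝ) (c : κ → ℝ) (I : Finset κ) : Prop :=
  IsBasis A I ∧ dualBasic A c I ᵥ* A ≤ c

/-- A basis which is both dual feasible and primal feasible (for the right-hand side `b`). -/
def IsPrimalDualFeasibleBasis (A : Matrix ι κ ℝ) (c : κ → ℝ) (b : ι → ℝ) (I : Finset κ) : Prop :=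
  IsDualFeasibleBasis A c I ∧ 0 ≤ primalBasic A I b

/-- The closed convex cone attached to a basis `I` and the optimal solution `xstar`: all `v` such
that the entries of `A_I⁻¹ v` at those indices of `I` at which `xstar` vanishes are nonnegative. -/
def cone (A : Matrix ι κ ℝ) (xstar : κ → ℝ) (I : Finset κ) : Set (ι → ℝ) :=
  {v | ∀ j ∈ I, xstar j = 0 → 0 ≤ primalBasic A I v j}

/-- The set `H_𝒦 \ ⋃_{k ∉ 𝒦} H_k`, where `H_𝒦 = ⋂_{k ∈ 𝒦} H_k`, for a family of cones. -/
def coneCell {K : ℕ} (H : Fin K → Set (ι → ℝ)) (𝒦 : Finset (Fin K)) : Set (ι → ℝ) :=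
  (⋂ k ∈ 𝒦, H k) \ ⋃ k ∉ 𝒦, H k

/-- The combination `α ⊗ x(I_𝒦, b) = ∑_{k ∈ 𝒦} α_k x(I_k, b)`. -/
def mix (A : Matrix ι κ ℝ) {K : ℕ} (I : Fin K → Finset κ) (𝒦 : Finset (Fin K)) (α : 𝒦 → ℝ)
    (b : ι → ℝ) : κ → ℝ :=
  ∑ k : 𝒦, α k • primalBasic A (I k) b

/-- The event that, among all dual feasible bases, exactly those indexed by `𝒦` are primal
feasible for the right-hand side `b`. -/
def FeasibleExactly (A : Matrix ι κ ℝ) (c : κ → ℝ) {K : ℕ} (I : Fin K → Finset κ)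
    (𝒦 : Finset (Fin K)) (b : ι → ℝ) : Prop :=
  ∀ J : Finset κ, IsDualFeasibleBasis A c J → (0 ≤ primalBasic A J b ↔ ∃ k ∈ 𝒦, I k = J)

/-- The sum over nonempty `𝒦 ⊆ [K]` of `1_{v ∈ H_𝒦 \ ⋃_{k ∉ 𝒦} H_k} α^𝒦 ⊗ x(I_𝒦, v)`. -/
def limitMap (A : Matrix ι κ ℝ) (xstar : κ → ℝ) {K : ℕ} (I : Fin K → Finset κ)
    (α : (𝒦 : Finset (Fin K)) → (𝒦 → ℝ)) (v : ι → ℝ) : κ → ℝ :=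
  ∑ 𝒦 : Finset (Fin K) with 𝒦.Nonempty,
    (coneCell (fun k => cone A xstar (I k)) 𝒦).indicator (fun v => mix A I 𝒦 (α 𝒦) v) v

/-- The sum over `k` of `1_{v ∈ H_k \ ⋃_{j < k} H_j} x(I_k, v)`. -/
def limitMapSingle (A : Matrix ι κ ℝ) (xstar : κ → ℝ) {K : ℕ} (I : Fin K → Finset κ)
    (v : ι → ℝ) : κ → ℝ :=
  ∑ k : Fin K,
    (cone A xstar (I k) \ ⋃ j < k, cone A xstar (I j)).indicator
      (fun v => primalBasic A (I k) v) v

lemma IsBasis.existsUnique_solution {A : Matrix ι κ ℝ} {I : Finset κ} (h : IsBasis A I)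
    (b : ι → ℝ) : ∃! x : κ → ℝ, A *ᵥ x = b ∧ ∀ j ∉ I, x j = 0 := by
  classical
  have key : ∀ x : κ → ℝ, (∀ j ∉ I, x j = 0) →
      A *ᵥ x = ∑ j : I, x j • (fun i => A i j) := by
    intro x hx
    funext i
    have h1 : ∑ j ∈ I, A i j * x j = ∑ j, A i j * x j :=
      Finset.sum_subset (Finset.subset_univ I) (fun j _ hj => by rw [hx j hj, mul_zero])
    rw [Finset.sum_apply]
    simp only [Matrix.mulVec, dotProduct, Pi.smul_apply, smul_eq_mul]
    rw [← h1, ← Finset.sum_coe_sort I]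
    exact Finset.sum_congr rfl (fun j _ => mul_comm _ _)
  have hspan : Submodule.span ℝ (Set.range fun j : I => fun i => A i j) = ⊤ :=
    h.2.span_eq_top_of_card_eq_finrank' (by simp [h.1])
  have hb : b ∈ Submodule.span ℝ (Set.range fun j : I => fun i => A i j) := by
    rw [hspan]; trivial
  obtain ⟨w, hw⟩ := (Submodule.mem_span_range_iff_exists_fun ℝ).1 hb
  refine ⟨fun j => if hj : j ∈ I then w ⟨j, hj⟩ else 0, ⟨?_, fun j hj => by simp [hj]⟩, ?_⟩
  · rw [key _ (fun j hj => by simp [hj]), ← hw]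
    exact Finset.sum_congr rfl (fun j _ => by simp)
  · rintro y ⟨hy, hy0⟩
    rw [key y hy0, ← hw, ← sub_eq_zero, ← Finset.sum_sub_distrib] at hy
    simp only [← sub_smul] at hy
    have h0 := Fintype.linearIndependent_iff.1 h.2 (fun j => y j - w j) hy
    funext j
    by_cases hj : j ∈ I
    · simpa [hj, sub_eq_zero] using h0 ⟨j, hj⟩
    · simp [hj, hy0 j hj]

/-- For a basis, `x(I, b)` is the unique solution of `A x = b` which vanishes outside `I`. -/
lemma primalBasic_eq_iff {A : Matrix ι κ ℝ} {I : Finset κ} (h : IsBasis A I) (b : ι → ℝ)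
    (x : κ → ℝ) : primalBasic A I b = x ↔ A *ᵥ x = b ∧ ∀ j ∉ I, x j = 0 := by
  have hu := h.existsUnique_solution b
  have hs : A *ᵥ primalBasic A I b = b ∧ ∀ j ∉ I, primalBasic A I b j = 0 := by
    unfold primalBasic
    rw [dif_pos hu.exists]
    exact hu.exists.choose_spec
  exact ⟨fun e => e ▸ hs, fun hx => hu.unique hs hx⟩

/-- For a basis, `λ(I)` is the unique solution of `λᵀ A_I = c_I`. -/
lemma dualBasic_eq_iff {A : Matrix ι κ ℝ} {I : Finset κ} (h : IsBasis A I) (c : κ → ℝ)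
    (l : ι → ℝ) : dualBasic A c I = l ↔ ∀ j ∈ I, (l ᵥ* A) j = c j := by
  classical
  have hinj : ∀ l : ι → ℝ, (∀ j ∈ I, (l ᵥ* A) j = 0) → l = 0 := by
    intro l hl
    obtain ⟨x, ⟨hx, hx0⟩, -⟩ := h.existsUnique_solution l
    have h1 : l ⬝ᵥ l = 0 := by
      have h2 : l ⬝ᵥ (A *ᵥ x) = 0 := by
        rw [Matrix.dotProduct_mulVec]
        refine Finset.sum_eq_zero (fun j _ => ?_)
        by_cases hj : j ∈ I
        · rw [hl j hj, zero_mul]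
        · rw [hx0 j hj, mul_zero]
      rwa [hx] at h2
    exact dotProduct_self_eq_zero.1 h1
  have hex : ∃ l : ι → ℝ, ∀ j ∈ I, (l ᵥ* A) j = c j := by
    let f : (ι → ℝ) →ₗ[ℝ] (I → ℝ) := LinearMap.funLeft ℝ ℝ (Subtype.val : I → κ) ∘ₗ A.vecMulLinear
    have hf : ∀ (l : ι → ℝ) (j : I), f l j = (l ᵥ* A) j := fun _ _ => rfl
    have hi : Function.Injective f := by
      rw [injective_iff_map_eq_zero]
      intro l hl
      exact hinj l (fun j hj => by rw [← hf l ⟨j, hj⟩, hl]; rfl)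
    have hsurj := (LinearMap.injective_iff_surjective_of_finrank_eq_finrank
      (by simp [h.1])).1 hi
    obtain ⟨l, hl⟩ := hsurj (fun j => c j)
    exact ⟨l, fun j hj => by rw [← hf l ⟨j, hj⟩, hl]⟩
  have hs : ∀ j ∈ I, (dualBasic A c I ᵥ* A) j = c j := by
    unfold dualBasic
    rw [dif_pos hex]
    exact hex.choose_spec
  refine ⟨fun e => e ▸ hs, fun hx => ?_⟩
  rw [← sub_eq_zero]
  exact hinj _ (fun j hj => by rw [Matrix.sub_vecMul, Pi.sub_apply, hs j hj, hx j hj, sub_self])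

end LP

namespace OT

/-- The reduced coefficient matrix `A_†` of the optimal transport problem on `N + 1` points:
couplings are indexed by pairs of points, the rows `Sum.inl i` take the first `N` row sums and the
rows `Sum.inr j` take all `N + 1` column sums. -/
def reducedMatrix (N : ℕ) : Matrix (Fin N ⊕ Fin (N + 1)) (Fin (N + 1) × Fin (N + 1)) ℝ
  | Sum.inl i, p => if p.1 = i.castSucc then 1 else 0
  | Sum.inr j, p => if p.2 = j then 1 else 0

/-- The vector `r_†` of the first `N` entries of `r ∈ ℝ^(N + 1)`. -/
def dagger {N : ℕ} (r : Fin (N + 1) → ℝ) : Fin N → ℝ := fun i => r i.castSucc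

/-- The right-hand side `(r_†, s)`. -/
def reducedRhs {N : ℕ} (r s : Fin (N + 1) → ℝ) : Fin N ⊕ Fin (N + 1) → ℝ :=
  Sum.elim (dagger r) s

/-- The relative interior of the probability simplex. -/
def riSimplex (ι : Type*) [Fintype ι] : Set (ι → ℝ) := {r | ∑ i, r i = 1 ∧ ∀ i, 0 < r i}

/-- The multinomial covariance matrix `Σ(v)`, with entries `v_i (1 - v_i)` on the diagonal and
`-v_i v_j` off the diagonal. -/
def multinomialCov {ι : Type*} [DecidableEq ι] (v : ι → ℝ) : Matrix ι ι ℝ :=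
  Matrix.of fun i j => if i = j then v i * (1 - v i) else -(v i * v j)

/-- The centred Gaussian law `G(v)` with covariance `Σ(v)`. (`Σ(v)` is positive semidefinite for
`v ≥ 0` with `∑ v ≤ 1`, see `multinomialCov_posSemidef`.) -/
def gaussianLimit {ι : Type*} [Fintype ι] [DecidableEq ι] (v : ι → ℝ) :
    Measure (EuclideanSpace ℝ ι) :=
  multivariateGaussian 0 (multinomialCov v)

/-- The empirical frequencies of the first `n` members of a sequence of random points. -/
def empirical {Ω : Type*} {N : ℕ} (Z : ℕ → Ω → Fin (N + 1)) (n : ℕ) (ω : Ω) : Fin (N + 1) → ℝ :=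
  fun i => (n : ℝ)⁻¹ * ∑ k ∈ Finset.range n, if Z k ω = i then 1 else 0

/-- The limit vector `G(r_†, s) = (√lam G¹, √(1 - lam) G²)`. -/
def gaussPair {N : ℕ} (lam : ℝ) (g₁ : EuclideanSpace ℝ (Fin N))
    (g₂ : EuclideanSpace ℝ (Fin (N + 1))) : Fin N ⊕ Fin (N + 1) → ℝ :=
  Sum.elim (fun i => √lam * g₁ i) (fun j => √(1 - lam) * g₂ j)

/-- The rate `√(n m / (n + m))`. -/
def rate (n m : ℕ) : ℝ := √((n : ℝ) * m / (n + m))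

lemma multinomialCov_posSemidef {ι : Type*} [Fintype ι] [DecidableEq ι] (v : ι → ℝ)
    (h0 : ∀ i, 0 ≤ v i) (h1 : ∑ i, v i ≤ 1) : (multinomialCov v).PosSemidef := by
  have hM : multinomialCov v = Matrix.diagonal v - Matrix.vecMulVec v v := by
    ext i j
    by_cases h : i = j
    · subst h; simp [multinomialCov, Matrix.vecMulVec_apply]; ring
    · simp [multinomialCov, Matrix.vecMulVec_apply, h]
  refine Matrix.PosSemidef.of_dotProduct_mulVec_nonneg ?_ (fun x => ?_)
  · ext i j
    by_cases h : i = j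
    · subst h; simp [multinomialCov]
    · simp [multinomialCov, h, Ne.symm h, mul_comm]
  · have hq : star x ⬝ᵥ multinomialCov v *ᵥ x = ∑ i, v i * x i ^ 2 - (∑ i, v i * x i) ^ 2 := by
      rw [hM, Matrix.sub_mulVec, dotProduct_sub]
      congr 1
      · simp only [dotProduct, Matrix.mulVec_diagonal]
        exact Finset.sum_congr rfl (fun i _ => by simp; ring)
      · rw [Matrix.vecMulVec_mulVec]
        simp only [dotProduct, sq, Finset.sum_mul, star_trivial]
        refine Finset.sum_congr rfl (fun i _ => ?_)
        simp
        ring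
    rw [hq, sub_nonneg]
    have hcs := Finset.sum_mul_sq_le_sq_mul_sq Finset.univ (fun i => √(v i))
      (fun i => √(v i) * x i)
    have e1 : ∀ i, √(v i) * (√(v i) * x i) = v i * x i := fun i => by
      rw [← mul_assoc, Real.mul_self_sqrt (h0 i)]
    simp only [e1, mul_pow, Real.sq_sqrt (h0 _)] at hcs
    have hnn : 0 ≤ ∑ i, v i * x i ^ 2 :=
      Finset.sum_nonneg (fun i _ => mul_nonneg (h0 i) (sq_nonneg _))
    exact hcs.trans (mul_le_of_le_one_left hnn h1)

end OT

end

/-! A basic solution is linear in the right-hand side, and by uniqueness of the optimum each `I k`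
has basic solution `πstar` at `b₀ = (r_†, s)`. Hence `ρ (π(I_k, b) - πstar) = π(I_k, ρ (b - b₀))`
holds exactly, and mixtures with weights of sum one obey the same identity. Close to `b₀`, only the
`I k` can be both dual and primal feasible, and `I k` is primal feasible exactly when `v = ρ (b -
b₀)` lies in its cone. So the rescaled error is a piecewise continuous function of the weights and
of `v`, with pieces given by the cells of the cones, and the central limit theorem sends `v` to `G`.

The obstacles are boundaries of cells and degenerate right-hand sides. Both are removed by
`OT.ae_linearMap_gaussPair_ne_zero`: a nonzero linear functional that vanishes at `b₀` is almost
surely nonzero at `G`. Vanishing at `b₀` is essential: the entries of `G²` sum to zero almost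
surely, but that sum equals one at `b₀`. The fact is applied to three kinds of functional: those
killing a proper span of columns that contains `b₀`, the coordinates `π(I_k, ·)_j` with `πstar j =
0`, and the differences of two dual solutions.

The first kind, together with openness for spans that miss `b₀`, makes the empirical right-hand side
nondegenerate with probability tending to one. Every extreme optimal solution then has a dual
feasible basis as its support (`LP.Nondegenerate.isDualFeasibleBasis_supp`), so some basis is
optimal. The second kind lets cells be replaced by closed sets, as
`tendstoInDistribution_of_closed_pieces` requires. That gluing theorem uses the convergence of each
piece separately, so no joint law of the weights for different `𝒦` is needed.

For distinct dual solutions, two cones meet only where the difference of their dual solutions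
vanishes, which is null for `G`. Off that set a single basis is optimal, and Krein–Milman shows that
it carries the only optimal solution. -/

set_option linter.unusedSectionVars false

noncomputable section

/-! ### Portmanteau inequalities and gluing along closed pieces. -/

namespace MeasureTheory

variable {Ω Ω' : Type*} {mΩ : MeasurableSpace Ω} {mΩ' : MeasurableSpace Ω'}
  {μ : Measure Ω} [IsProbabilityMeasure μ] {ν : Measure Ω'} [IsProbabilityMeasure ν]

/-- The portmanteau inequality for closed sets, for random variables. -/
lemma TendstoInDistribution.limsup_measure_closed_le {E : Type*} [TopologicalSpace E]
    [MeasurableSpace E] [OpensMeasurableSpace E] [HasOuterApproxClosed E]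
    {X : ℕ → Ω → E} {Z : Ω' → E} (h : TendstoInDistribution X atTop Z (fun _ => μ) ν)
    {C : Set E} (hC : IsClosed C) :
    limsup (fun t => μ {ω | X t ω ∈ C}) atTop ≤ ν {ω | Z ω ∈ C} := by
  have := ProbabilityMeasure.limsup_measure_closed_le_of_tendsto h.tendsto hC
  simp only [ProbabilityMeasure.coe_mk] at this
  rw [Measure.map_apply_of_aemeasurable h.aemeasurable_limit hC.measurableSet] at this
  refine le_trans (le_of_eq ?_) this
  congr 1
  funext t
  rw [Measure.map_apply_of_aemeasurable (h.forall_aemeasurable t) hC.measurableSet]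
  rfl

/-- A closed set which is null for the limit law asymptotically carries no mass. -/
lemma TendstoInDistribution.tendsto_measure_closed_zero {E : Type*} [TopologicalSpace E]
    [MeasurableSpace E] [OpensMeasurableSpace E] [HasOuterApproxClosed E]
    {X : ℕ → Ω → E} {Z : Ω' → E} (h : TendstoInDistribution X atTop Z (fun _ => μ) ν)
    {C : Set E} (hC : IsClosed C) (h0 : ∀ᵐ ω ∂ν, Z ω ∉ C) :
    Tendsto (fun t => μ {ω | X t ω ∈ C}) atTop (𝓝 0) := by
  refine tendsto_of_le_liminf_of_limsup_le (by simp) ?_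
  refine (h.limsup_measure_closed_le hC).trans (le_of_eq ?_)
  simpa [ae_iff] using h0

lemma limsup_add_le_ennreal (u v : ℕ → ENNReal) :
    limsup (fun t => u t + v t) atTop ≤ limsup u atTop + limsup v atTop := by
  refine ENNReal.le_of_forall_pos_le_add fun ε hε hfin => ?_
  have hε2 : ((ε / 2 : NNReal) : ENNReal) ≠ 0 := by simpa using hε.ne'
  have hu : limsup u atTop ≠ ⊤ := (le_self_add.trans_lt hfin).ne
  have hv : limsup v atTop ≠ ⊤ := (le_add_self.trans_lt hfin).ne
  have h1 := eventually_lt_of_limsup_lt (ENNReal.lt_add_right hu hε2)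
  have h2 := eventually_lt_of_limsup_lt (ENNReal.lt_add_right hv hε2)
  refine limsup_le_of_le (by isBoundedDefault) ?_
  filter_upwards [h1, h2] with t h1 h2
  refine (add_le_add h1.le h2.le).trans (le_of_eq ?_)
  rw [add_add_add_comm, ← ENNReal.coe_add, add_halves]

lemma limsup_finsetSum_le_ennreal {J : Type*} (T : Finset J) (u : J → ℕ → ENNReal) :
    limsup (fun t => ∑ i ∈ T, u i t) atTop ≤ ∑ i ∈ T, limsup (u i) atTop := by
  classical
  induction T using Finset.induction_on with
  | empty => simp
  | insert a T ha ih =>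
    simp only [Finset.sum_insert ha]
    exact (limsup_add_le_ennreal _ _).trans (by gcongr)

/-- Convergence in distribution by gluing: if, with probability tending to one, `W t` is a
continuous function of some `Z i t` lying in a closed set `C i`, and the limit is almost surely
described by the same rule, the events `Z' i ∈ C i` being almost surely disjoint, then `W t`
converges in distribution. -/
theorem tendstoInDistribution_of_closed_pieces {F : Type*} [TopologicalSpace F]
    [MeasurableSpace F] [BorelSpace F] [HasOuterApproxClosed F] {J : Type*} [Finite J]
    {E : J → Type*} [∀ i, TopologicalSpace (E i)] [∀ i, MeasurableSpace (E i)]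
    [∀ i, OpensMeasurableSpace (E i)] [∀ i, HasOuterApproxClosed (E i)]
    {W : ℕ → Ω → F} {W' : Ω' → F} {Z : ∀ i, ℕ → Ω → E i} {Z' : ∀ i, Ω' → E i}
    (hZ : ∀ i, TendstoInDistribution (Z i) atTop (Z' i) (fun _ => μ) ν)
    (C : ∀ i, Set (E i)) (hC : ∀ i, IsClosed (C i)) (f : ∀ i, E i → F)
    (hf : ∀ i, Continuous (f i)) (hW : ∀ t, AEMeasurable (W t) μ) (hW' : AEMeasurable W' ν)
    (hbad : Tendsto (fun t => μ {ω | ¬ ∃ i, Z i t ω ∈ C i ∧ W t ω = f i (Z i t ω)}) atTop (𝓝 0))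
    (hlim : ∀ᵐ ω ∂ν, ∀ i, Z' i ω ∈ C i → W' ω = f i (Z' i ω))
    (hdisj : ∀ᵐ ω ∂ν, ∀ i j, Z' i ω ∈ C i → Z' j ω ∈ C j → i = j) :
    TendstoInDistribution W atTop W' (fun _ => μ) ν := by
  classical
  have := Fintype.ofFinite J
  refine ⟨hW, hW', ?_⟩
  refine tendsto_of_forall_isClosed_limsup_le' fun S hS => ?_
  simp only [ProbabilityMeasure.coe_mk]
  rw [Measure.map_apply_of_aemeasurable hW' hS.measurableSet]
  have hD : ∀ i, IsClosed (C i ∩ f i ⁻¹' S) := fun i => (hC i).inter (hS.preimage (hf i))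
  have h1 : ∀ t, (μ.map (W t)) S ≤
      μ {ω | ¬ ∃ i, Z i t ω ∈ C i ∧ W t ω = f i (Z i t ω)}
        + ∑ i, μ {ω | Z i t ω ∈ C i ∩ f i ⁻¹' S} := by
    intro t
    rw [Measure.map_apply_of_aemeasurable (hW t) hS.measurableSet]
    calc μ (W t ⁻¹' S) ≤ μ ({ω | ¬ ∃ i, Z i t ω ∈ C i ∧ W t ω = f i (Z i t ω)} ∪
          ⋃ i ∈ (Finset.univ : Finset J), {ω | Z i t ω ∈ C i ∩ f i ⁻¹' S}) := by
          refine measure_mono fun ω hω => ?_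
          by_cases hex : ∃ i, Z i t ω ∈ C i ∧ W t ω = f i (Z i t ω)
          · right
            obtain ⟨i, hi, he⟩ := hex
            simp only [Set.mem_iUnion]
            exact ⟨i, Finset.mem_univ i, hi, by
              change f i (Z i t ω) ∈ S
              rw [← he]; exact hω⟩
          · exact Or.inl hex
      _ ≤ _ := (measure_union_le _ _).trans (by gcongr; exact measure_biUnion_finset_le _ _)
  have h2 : limsup (fun t => (μ.map (W t)) S) atTop ≤
      ∑ i, ν {ω | Z' i ω ∈ C i ∩ f i ⁻¹' S} := by
    refine (limsup_le_limsup (Eventually.of_forall h1)).trans ?_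
    refine (limsup_add_le_ennreal _ _).trans ?_
    rw [hbad.limsup_eq, zero_add]
    refine (limsup_finsetSum_le_ennreal _ _).trans ?_
    exact Finset.sum_le_sum fun i _ => (hZ i).limsup_measure_closed_le (hD i)
  refine h2.trans ?_
  -- Almost sure disjointness turns the sum of the limit masses into the mass of a union, which lies
  -- in `W' ∈ S` up to a null set. The union need not be shown to have full mass.
  rw [← measure_biUnion_finset₀]
  · refine measure_mono_ae ?_
    filter_upwards [hlim] with ω h hω
    simp only [Finset.mem_univ, Set.iUnion_true] at hω
    obtain ⟨i, hi, hS'⟩ := Set.mem_iUnion.1 hω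
    change W' ω ∈ S
    rw [h i hi]
    exact hS'
  · intro i _ j _ hij
    change ν _ = 0
    rw [measure_eq_zero_iff_ae_notMem]
    filter_upwards [hdisj] with ω h hω
    exact hij (h i j hω.1.1 hω.2.1)
  · intro i _
    exact (hZ i).aemeasurable_limit.nullMeasurableSet_preimage (hD i).measurableSet

end MeasureTheory

/-! ### Linear programming: basic solutions, duality and extreme optimal solutions. -/

namespace LP

variable {ι κ : Type*} [Fintype ι] [Fintype κ] {A : Matrix ι κ ℝ} {c : κ → ℝ} {b : ι → ℝ}
  {I : Finset κ}

lemma IsBasis.mulVec_primalBasic (h : IsBasis A I) (b : ι → ℝ) :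
    A *ᵥ primalBasic A I b = b := ((primalBasic_eq_iff h b _).1 rfl).1

lemma IsBasis.primalBasic_apply_of_notMem (h : IsBasis A I) (b : ι → ℝ) {j : κ} (hj : j ∉ I) :
    primalBasic A I b j = 0 := ((primalBasic_eq_iff h b _).1 rfl).2 j hj

/-- The basic solution as a linear map of the right-hand side. -/
def primalBasicLin (h : IsBasis A I) : (ι → ℝ) →ₗ[ℝ] (κ → ℝ) where
  toFun := primalBasic A I
  map_add' b b' := by
    rw [primalBasic_eq_iff h]
    refine ⟨by rw [Matrix.mulVec_add, h.mulVec_primalBasic, h.mulVec_primalBasic], fun j hj => ?_⟩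
    simp [h.primalBasic_apply_of_notMem _ hj]
  map_smul' a b := by
    rw [primalBasic_eq_iff h]
    refine ⟨by simp [Matrix.mulVec_smul, h.mulVec_primalBasic], fun j hj => ?_⟩
    simp [h.primalBasic_apply_of_notMem _ hj]

@[simp]
lemma primalBasicLin_apply (h : IsBasis A I) (b : ι → ℝ) :
    primalBasicLin h b = primalBasic A I b := rfl

lemma IsBasis.continuous_primalBasic (h : IsBasis A I) : Continuous (primalBasic A I) :=
  (primalBasicLin h).continuous_of_finiteDimensional

/-- Complementary slackness: on `I` the dual constraints are tight, and off `I` the primal solution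
vanishes. With weak duality this makes a basis that is feasible on both sides optimal. -/
lemma IsBasis.dotProduct_primalBasic (h : IsBasis A I) (c : κ → ℝ) (b : ι → ℝ) :
    c ⬝ᵥ primalBasic A I b = dualBasic A c I ⬝ᵥ b := by
  conv_rhs => rw [← h.mulVec_primalBasic b, Matrix.dotProduct_mulVec]
  refine Finset.sum_congr rfl fun j _ => ?_
  by_cases hj : j ∈ I
  · rw [(dualBasic_eq_iff h c _).1 rfl j hj]
  · simp [h.primalBasic_apply_of_notMem b hj]

lemma dotProduct_le_of_dual_feasible {l : ι → ℝ} (hl : l ᵥ* A ≤ c) {x : κ → ℝ}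
    (hx : x ∈ feasibleSet A b) : l ⬝ᵥ b ≤ c ⬝ᵥ x := by
  rw [← hx.1, Matrix.dotProduct_mulVec]
  exact Finset.sum_le_sum fun j _ => mul_le_mul_of_nonneg_right (hl j) (hx.2 j)

lemma IsPrimalDualFeasibleBasis.primalBasic_mem_optSet (h : IsPrimalDualFeasibleBasis A c b I) :
    primalBasic A I b ∈ optSet A c b := by
  refine ⟨⟨h.1.1.mulVec_primalBasic b, h.2⟩, fun y hy => ?_⟩
  rw [h.1.1.dotProduct_primalBasic]
  exact dotProduct_le_of_dual_feasible h.1.2 hy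

/-- All optimal bases have the same dual objective value. -/
lemma IsPrimalDualFeasibleBasis.dualBasic_dotProduct_eq {J : Finset κ}
    (hI : IsPrimalDualFeasibleBasis A c b I) (hJ : IsPrimalDualFeasibleBasis A c b J) :
    dualBasic A c I ⬝ᵥ b = dualBasic A c J ⬝ᵥ b := by
  have hx := hI.primalBasic_mem_optSet
  have hy := hJ.primalBasic_mem_optSet
  rw [← hI.1.1.dotProduct_primalBasic, ← hJ.1.1.dotProduct_primalBasic]
  exact le_antisymm (hx.2 _ hy.1) (hy.2 _ hx.1)

lemma isClosed_feasibleSet (A : Matrix ι κ ℝ) (b : ι → ℝ) : IsClosed (feasibleSet A b) :=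
  (isClosed_eq (by fun_prop) continuous_const).inter (isClosed_le continuous_const continuous_id)

lemma isClosed_optSet (A : Matrix ι κ ℝ) (c : κ → ℝ) (b : ι → ℝ) : IsClosed (optSet A c b) := by
  have : optSet A c b =
      feasibleSet A b ∩ ⋂ y ∈ feasibleSet A b, {x | c ⬝ᵥ x ≤ c ⬝ᵥ y} := by
    ext x; simp [optSet]
  rw [this]
  refine (isClosed_feasibleSet A b).inter (isClosed_biInter fun y _ => ?_)
  exact isClosed_le (by fun_prop) continuous_const

lemma convex_feasibleSet (A : Matrix ι κ ℝ) (b : ι → ℝ) : Convex ℝ (feasibleSet A b) := by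
  intro x hx y hy p q hp hq hpq
  refine ⟨?_, ?_⟩
  · rw [Matrix.mulVec_add, Matrix.mulVec_smul, Matrix.mulVec_smul, hx.1, hy.1, ← add_smul, hpq,
      one_smul]
  · exact add_nonneg (smul_nonneg hp hx.2) (smul_nonneg hq hy.2)

lemma convex_optSet (A : Matrix ι κ ℝ) (c : κ → ℝ) (b : ι → ℝ) : Convex ℝ (optSet A c b) := by
  intro x hx y hy p q hp hq hpq
  refine ⟨convex_feasibleSet A b hx.1 hy.1 hp hq hpq, fun z hz => ?_⟩
  have h1 := mul_le_mul_of_nonneg_left (hx.2 z hz) hp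
  have h2 := mul_le_mul_of_nonneg_left (hy.2 z hz) hq
  rw [dotProduct_add, dotProduct_smul, dotProduct_smul, smul_eq_mul, smul_eq_mul]
  calc _ ≤ (p + q) * (c ⬝ᵥ z) := by linarith
    _ = _ := by rw [hpq, one_mul]

/-- Positive coordinates tolerate any small perturbation, so only the vanishing ones constrain the
direction. -/
lemma eventually_nonneg_add_smul {x d : κ → ℝ} (hx : 0 ≤ x) (hd : ∀ j, x j = 0 → 0 ≤ d j) :
    ∀ᶠ ε : ℝ in 𝓝[>] 0, 0 ≤ x + ε • d := by
  have : ∀ j, ∀ᶠ ε : ℝ in 𝓝[>] 0, 0 ≤ x j + ε * d j := by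
    intro j
    rcases (hx j).eq_or_lt with h0 | h0
    · filter_upwards [self_mem_nhdsWithin] with ε hε
      have h0' : x j = 0 := h0.symm
      rw [h0', zero_add]
      exact mul_nonneg (le_of_lt hε) (hd j h0')
    · have hc : Tendsto (fun ε : ℝ => x j + ε * d j) (𝓝 0) (𝓝 (x j + 0 * d j)) :=
        Continuous.tendsto (by fun_prop) 0
      rw [zero_mul, add_zero] at hc
      exact (hc.eventually_const_lt h0).filter_mono nhdsWithin_le_nhds |>.mono fun _ h => h.le
  filter_upwards [eventually_all.2 this] with ε h j using h j

/-- Optimality in a feasible direction. -/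
lemma dotProduct_nonneg_of_direction {x d : κ → ℝ} (hx : x ∈ optSet A c b) (hAd : A *ᵥ d = 0)
    (hd : ∀ j, x j = 0 → 0 ≤ d j) : 0 ≤ c ⬝ᵥ d := by
  obtain ⟨ε, hε, hpos⟩ := ((eventually_nonneg_add_smul hx.1.2 hd).and self_mem_nhdsWithin).exists
  have h := hx.2 (x + ε • d) ⟨by rw [Matrix.mulVec_add, Matrix.mulVec_smul, hAd, hx.1.1]; simp, hε⟩
  rw [dotProduct_add, dotProduct_smul, smul_eq_mul] at h
  exact nonneg_of_mul_nonneg_right (by linarith) (show (0 : ℝ) < ε from hpos)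

open Classical in
/-- The support of a vector. -/
def supp (x : κ → ℝ) : Finset κ := Finset.univ.filter fun j => x j ≠ 0

@[simp]
lemma mem_supp {x : κ → ℝ} {j : κ} : j ∈ supp x ↔ x j ≠ 0 := by simp [supp]

lemma mulVec_eq_sum_of_support (x : κ → ℝ) (hx : ∀ j ∉ I, x j = 0) :
    A *ᵥ x = ∑ j : I, x j • (fun i => A i j) := by
  rw [Finset.sum_coe_sort I (fun j => x j • (fun i => A i j)),
    Finset.sum_subset (Finset.subset_univ I) (fun j _ hj => by rw [hx j hj, zero_smul])]
  funext i
  simp [Matrix.mulVec, dotProduct, mul_comm]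

/-- A relation between the columns in the support is a vector `d` with `A d = 0` along which both
signs are feasible. Optimality forces `c ⬝ᵥ d = 0`, so `x` is the midpoint of the optimal points `x
± ε d`, and extremality gives `d = 0`. -/
lemma linearIndependent_supp_of_extreme {x : κ → ℝ} (hx : x ∈ (optSet A c b).extremePoints ℝ) :
    LinearIndependent ℝ (fun j : supp x => fun i => A i j) := by
  classical
  rw [Fintype.linearIndependent_iff]
  intro g hg
  set d : κ → ℝ := fun j => if h : j ∈ supp x then g ⟨j, h⟩ else 0 with hd
  have hd0 : ∀ j ∉ supp x, d j = 0 := fun j hj => by simp only [hd, dif_neg hj]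
  have hdg : ∀ j : supp x, d j = g j := fun j => by simp only [hd, dif_pos j.2]
  have hAd : A *ᵥ d = 0 := by
    rw [mulVec_eq_sum_of_support d hd0, ← hg]
    simp only [hdg]
  have hz : ∀ j, x j = 0 → d j = 0 := fun j hj => hd0 j (by simpa using hj)
  have hopt := hx.1
  have h1 := dotProduct_nonneg_of_direction hopt hAd fun j hj => (hz j hj).ge
  have h2 := dotProduct_nonneg_of_direction (d := -d) hopt (by rw [Matrix.mulVec_neg, hAd, neg_zero])
    fun j hj => by simp [hz j hj]
  rw [dotProduct_neg] at h2
  have hcd : c ⬝ᵥ d = 0 := by linarith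
  obtain ⟨ε, ⟨hp, hm⟩, hpos⟩ := (((eventually_nonneg_add_smul hopt.1.2
    fun j hj => (hz j hj).ge).and (eventually_nonneg_add_smul (d := -d) hopt.1.2
    fun j hj => by simp [hz j hj])).and self_mem_nhdsWithin).exists
  have hmem : ∀ e : κ → ℝ, A *ᵥ e = 0 → c ⬝ᵥ e = 0 → 0 ≤ x + ε • e → x + ε • e ∈ optSet A c b := by
    intro e hAe hce hnn
    refine ⟨⟨by rw [Matrix.mulVec_add, Matrix.mulVec_smul, hAe, hopt.1.1]; simp, hnn⟩,
      fun y hy => ?_⟩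
    rw [dotProduct_add, dotProduct_smul, hce, smul_zero, add_zero]
    exact hopt.2 y hy
  have hseg : x ∈ openSegment ℝ (x + ε • d) (x + ε • -d) :=
    ⟨1 / 2, 1 / 2, by norm_num, by norm_num, by norm_num, by
      funext j; simp; ring⟩
  have he := hx.2 (hmem d hAd hcd hp)
    (hmem (-d) (by rw [Matrix.mulVec_neg, hAd, neg_zero]) (by rw [dotProduct_neg, hcd, neg_zero]) hm)
    hseg
  have hd' : ε • d = 0 := by simpa using he
  have : d = 0 := (smul_eq_zero.1 hd').resolve_left (ne_of_gt hpos)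
  intro j
  rw [← hdg j, this]
  rfl

/-- The span of the columns indexed by `T`. -/
def colSpan (A : Matrix ι κ ℝ) (T : Finset κ) : Submodule ℝ (ι → ℝ) :=
  Submodule.span ℝ (Set.range fun j : T => fun i => A i j)

lemma finrank_colSpan_le (A : Matrix ι κ ℝ) (T : Finset κ) :
    Module.finrank ℝ (colSpan A T) ≤ T.card :=
  (finrank_range_le_card (R := ℝ) fun j : T => fun i => A i j).trans (by simp)

lemma colSpan_ne_top {T : Finset κ} (hT : T.card < Fintype.card ι) : colSpan A T ≠ ⊤ := by
  intro h
  have := finrank_colSpan_le A T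
  rw [h, finrank_top, Module.finrank_fintype_fun_eq_card] at this
  omega

/-- A right-hand side is nondegenerate if it is not in the span of fewer columns than there are
rows. -/
def Nondegenerate (A : Matrix ι κ ℝ) (b : ι → ℝ) : Prop :=
  ∀ T : Finset κ, T.card < Fintype.card ι → b ∉ colSpan A T

/-- Independence bounds the support above by the number of rows, and nondegeneracy bounds it below,
so the support is a basis on which `x` is positive. Positivity is what yields dual feasibility: any
column may enter the basis with a small weight, and optimality makes its reduced cost nonnegative.
-/
lemma Nondegenerate.isDualFeasibleBasis_supp (hb : Nondegenerate A b) {x : κ → ℝ}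
    (hx : x ∈ (optSet A c b).extremePoints ℝ) :
    IsDualFeasibleBasis A c (supp x) ∧ primalBasic A (supp x) b = x := by
  classical
  have hli := linearIndependent_supp_of_extreme hx
  have hopt := hx.1
  have hx0 : ∀ j ∉ supp x, x j = 0 := fun j hj => by simpa using hj
  have hcard : (supp x).card = Fintype.card ι := by
    refine le_antisymm ?_ (not_lt.1 fun hlt => hb _ hlt ?_)
    · have := hli.fintype_card_le_finrank
      rwa [Fintype.card_coe, Module.finrank_fintype_fun_eq_card] at this
    · rw [← hopt.1.1, mulVec_eq_sum_of_support x hx0]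
      exact Submodule.sum_mem _ fun j _ =>
        Submodule.smul_mem _ _ (Submodule.subset_span ⟨j, rfl⟩)
  have hbas : IsBasis A (supp x) := ⟨hcard, hli⟩
  refine ⟨⟨hbas, fun j => ?_⟩, (primalBasic_eq_iff hbas b x).2 ⟨hopt.1.1, hx0⟩⟩
  -- The direction raises coordinate `j` and compensates on the basis; its cost is the reduced cost
  -- `c j - (λ(I)ᵀ A) j`.
  have hdir := dotProduct_nonneg_of_direction (c := c)
    (d := Pi.single j 1 - primalBasic A (supp x) (A *ᵥ Pi.single j 1)) hopt
    (by rw [Matrix.mulVec_sub, hbas.mulVec_primalBasic, sub_self])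
    (fun k hk => by
      rw [Pi.sub_apply, hbas.primalBasic_apply_of_notMem _ (by simpa using hk), sub_zero]
      exact (Pi.single_nonneg.2 zero_le_one : (0 : κ → ℝ) ≤ Pi.single j 1) k)
  rw [dotProduct_sub, hbas.dotProduct_primalBasic, Matrix.dotProduct_mulVec] at hdir
  simpa using hdir

lemma Nondegenerate.exists_isPrimalDualFeasibleBasis (hb : Nondegenerate A b)
    (hc : IsCompact (optSet A c b)) (hne : (optSet A c b).Nonempty) :
    ∃ J, IsPrimalDualFeasibleBasis A c b J := by
  obtain ⟨x, hx⟩ := hc.extremePoints_nonempty (E := κ → ℝ) hne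
  obtain ⟨h1, h2⟩ := hb.isDualFeasibleBasis_supp hx
  exact ⟨supp x, h1, by rw [h2]; exact hx.1.1.2⟩

/-- Every extreme optimal solution is the basic solution of its support, hence of `I`; by
Krein–Milman the compact convex optimal set is that single point. -/
lemma Nondegenerate.eq_primalBasic_of_unique (hb : Nondegenerate A b)
    (hc : IsCompact (optSet A c b)) (huniq : ∀ J, IsPrimalDualFeasibleBasis A c b J → J = I)
    {x : κ → ℝ} (hx : x ∈ optSet A c b) : x = primalBasic A I b := by
  have hsub : (optSet A c b).extremePoints ℝ ⊆ {primalBasic A I b} := by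
    intro y hy
    obtain ⟨h1, h2⟩ := hb.isDualFeasibleBasis_supp hy
    rw [Set.mem_singleton_iff, ← huniq (supp y) ⟨h1, by rw [h2]; exact hy.1.1.2⟩, h2]
  rw [← closure_convexHull_extremePoints hc (convex_optSet A c b)] at hx
  have := closure_mono (convexHull_mono (𝕜 := ℝ) hsub) hx
  simpa using this

/-! ### Optimal bases for right-hand sides near `b₀`. -/

section Stability

variable {K : ℕ} {I : Fin K → Finset κ} {b₀ : ι → ℝ} {xstar : κ → ℝ}

/-- Primal infeasibility is an open condition on `b`, and there are only finitely many bases. -/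
lemma eventually_mem_range_of_feasible
    (hI : Set.range I = {J | IsPrimalDualFeasibleBasis A c b₀ J}) :
    ∀ᶠ b in 𝓝 b₀, ∀ J, IsPrimalDualFeasibleBasis A c b J → ∃ k, I k = J := by
  refine eventually_all.2 fun J => ?_
  by_cases hJ : ∃ k, I k = J
  · exact Eventually.of_forall fun _ _ => hJ
  by_cases hd : IsDualFeasibleBasis A c J
  · have hJ' : ¬ 0 ≤ primalBasic A J b₀ := fun h => hJ (by
      have : J ∈ Set.range I := by rw [hI]; exact ⟨hd, h⟩
      exact this)
    have hop : IsOpen {b | ¬ 0 ≤ primalBasic A J b} :=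
      (isClosed_le continuous_const hd.1.continuous_primalBasic).isOpen_compl
    filter_upwards [hop.mem_nhds hJ'] with b hb h
    exact absurd h.2 hb
  · exact Eventually.of_forall fun _ h => absurd h.1 hd

lemma isPrimalDualFeasibleBasis_of_range
    (hI : Set.range I = {J | IsPrimalDualFeasibleBasis A c b₀ J}) (k : Fin K) :
    IsPrimalDualFeasibleBasis A c b₀ (I k) := by
  have : I k ∈ Set.range I := ⟨k, rfl⟩
  rw [hI] at this
  exact this

lemma primalBasic_eq_of_unique (hunique : optSet A c b₀ = {xstar}) {J : Finset κ}
    (hJ : IsPrimalDualFeasibleBasis A c b₀ J) : primalBasic A J b₀ = xstar := by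
  have := hJ.primalBasic_mem_optSet
  rwa [hunique] at this

/-- By linearity the expansion around `b₀` has no remainder, so no delta method is needed. -/
lemma primalBasic_eq_add_smul (hunique : optSet A c b₀ = {xstar}) {J : Finset κ}
    (hJ : IsPrimalDualFeasibleBasis A c b₀ J) {ρ : ℝ} (hρ : 0 < ρ) (b : ι → ℝ) :
    primalBasic A J b = xstar + ρ⁻¹ • primalBasic A J (ρ • (b - b₀)) := by
  rw [← primalBasic_eq_of_unique hunique hJ]
  simp only [← primalBasicLin_apply hJ.1.1, map_smul, map_sub, smul_smul, inv_mul_cancel₀ hρ.ne',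
    one_smul, add_sub_cancel]

/-- Near `b₀`, feasibility of an optimal basis is governed by its cone. -/
lemma eventually_feasible_iff_mem_cone (hunique : optSet A c b₀ = {xstar})
    (hI : Set.range I = {J | IsPrimalDualFeasibleBasis A c b₀ J}) :
    ∀ᶠ b in 𝓝 b₀, ∀ k, ∀ ρ : ℝ, 0 < ρ →
      (0 ≤ primalBasic A (I k) b ↔ ρ • (b - b₀) ∈ cone A xstar (I k)) := by
  have hx : 0 ≤ xstar := by
    have : xstar ∈ optSet A c b₀ := by rw [hunique]; rfl
    exact this.1.2
  -- Coordinates positive at `xstar` stay positive near `b₀`; only the others can decide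
  -- feasibility, and these are the ones listed in the cone.
  have hpos : ∀ k j, ∀ᶠ b in 𝓝 b₀, xstar j ≠ 0 → 0 ≤ primalBasic A (I k) b j := by
    intro k j
    have hk := isPrimalDualFeasibleBasis_of_range hI k
    by_cases h0 : xstar j = 0
    · exact Eventually.of_forall fun _ h => absurd h0 h
    · have hc : Continuous fun b => primalBasic A (I k) b j :=
        (continuous_apply j).comp hk.1.1.continuous_primalBasic
      have hlt : 0 < primalBasic A (I k) b₀ j := by
        rw [primalBasic_eq_of_unique hunique hk]
        exact lt_of_le_of_ne (hx j) (Ne.symm h0)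
      filter_upwards [hc.continuousAt.eventually_const_lt hlt] with b hb _ using hb.le
  filter_upwards [eventually_all.2 fun k => eventually_all.2 (hpos k)] with b hb k ρ hρ
  have hk := isPrimalDualFeasibleBasis_of_range hI k
  have he := primalBasic_eq_add_smul hunique hk hρ b
  have hj : ∀ j, xstar j = 0 → (0 ≤ primalBasic A (I k) b j ↔
      0 ≤ primalBasic A (I k) (ρ • (b - b₀)) j) := by
    intro j h0
    rw [he, Pi.add_apply, h0, zero_add, Pi.smul_apply, smul_eq_mul]
    exact mul_nonneg_iff_of_pos_left (inv_pos.2 hρ)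
  constructor
  · intro h j _ h0
    exact (hj j h0).1 (h j)
  · intro h j
    by_cases h0 : xstar j = 0
    · by_cases hjI : j ∈ I k
      · exact (hj j h0).2 (h j hjI h0)
      · exact (hk.1.1.primalBasic_apply_of_notMem b hjI).ge
    · exact hb k j h0

/-- Small spans that miss `b₀` are closed, hence also missed nearby. If a span contains both `b₀`
and `b`, it contains every multiple of `b - b₀`, which the hypothesis excludes. -/
lemma eventually_nondegenerate (A : Matrix ι κ ℝ) (b₀ : ι → ℝ) :
    ∀ᶠ b in 𝓝 b₀, ∀ ρ : ℝ, (∀ T : Finset κ, T.card < Fintype.card ι → b₀ ∈ colSpan A T →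
      ρ • (b - b₀) ∉ colSpan A T) → Nondegenerate A b := by
  have : ∀ T : Finset κ, ∀ᶠ b in 𝓝 b₀, b₀ ∉ colSpan A T → b ∉ colSpan A T := by
    intro T
    by_cases h : b₀ ∈ colSpan A T
    · exact Eventually.of_forall fun _ h' => absurd h h'
    · have hop : IsOpen ((colSpan A T : Set (ι → ℝ))ᶜ) :=
        (Submodule.closed_of_finiteDimensional _).isOpen_compl
      filter_upwards [hop.mem_nhds h] with b hb _ using hb
  filter_upwards [eventually_all.2 this] with b hb ρ hρ T hT hmem
  by_cases h : b₀ ∈ colSpan A T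
  · exact hρ T hT h (Submodule.smul_mem _ _ (Submodule.sub_mem _ hmem h))
  · exact hb T h hmem

end Stability

end LP

/-! ### The Cramér–Wold device. -/

namespace MeasureTheory

variable {Ω Ω' : Type*} {mΩ : MeasurableSpace Ω} {mΩ' : MeasurableSpace Ω'}
  {μ : Measure Ω} [IsProbabilityMeasure μ] {ν : Measure Ω'} [IsProbabilityMeasure ν]

lemma charFun_map_toLp {ι : Type*} [Fintype ι] {V : Ω → ι → ℝ} (hV : AEMeasurable V μ)
    (u : EuclideanSpace ℝ ι) :
    charFun (μ.map fun ω => WithLp.toLp 2 (V ω)) u = charFun (μ.map fun ω => u.ofLp ⬝ᵥ V ω) 1 := by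
  have hm : AEMeasurable (fun ω => WithLp.toLp 2 (V ω)) μ :=
    (PiLp.continuous_toLp 2 _).measurable.comp_aemeasurable hV
  have hm' : AEMeasurable (fun ω => u.ofLp ⬝ᵥ V ω) μ :=
    (show Continuous fun v : ι → ℝ => u.ofLp ⬝ᵥ v by fun_prop).measurable.comp_aemeasurable hV
  rw [charFun_apply, charFun_apply, integral_map hm (by fun_prop), integral_map hm' (by fun_prop)]
  simp [EuclideanSpace.inner_eq_star_dotProduct]

/-- The Cramér–Wold device, in terms of characteristic functions of linear combinations. -/
theorem tendstoInDistribution_of_charFun_dotProduct {ι : Type*} [Fintype ι]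
    {X : ℕ → Ω → ι → ℝ} {Z : Ω' → ι → ℝ} (hX : ∀ t, AEMeasurable (X t) μ) (hZ : AEMeasurable Z ν)
    (h : ∀ u : ι → ℝ, Tendsto (fun t => charFun (μ.map fun ω => u ⬝ᵥ X t ω) 1) atTop
      (𝓝 (charFun (ν.map fun ω => u ⬝ᵥ Z ω) 1))) :
    TendstoInDistribution X atTop Z (fun _ => μ) ν := by
  have hlp : TendstoInDistribution (fun t ω => (WithLp.toLp 2 (X t ω) : EuclideanSpace ℝ ι)) atTop
      (fun ω => WithLp.toLp 2 (Z ω)) (fun _ => μ) ν := by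
    refine ⟨fun t => (PiLp.continuous_toLp 2 _).measurable.comp_aemeasurable (hX t),
      (PiLp.continuous_toLp 2 _).measurable.comp_aemeasurable hZ, ?_⟩
    refine ProbabilityMeasure.tendsto_iff_tendsto_charFun.2 fun u => ?_
    simp only [ProbabilityMeasure.coe_mk]
    rw [charFun_map_toLp hZ u]
    simp only [charFun_map_toLp (hX _) u]
    exact h u.ofLp
  exact hlp.continuous_comp (g := fun x => x.ofLp) (PiLp.continuous_ofLp 2 _)

end MeasureTheory

/-! ### Sample sums, their variances and the scalar central limit theorem. -/

namespace OT

variable {Ω Ω' : Type*} {mΩ : MeasurableSpace Ω} {mΩ' : MeasurableSpace Ω'}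
  {μ : Measure Ω} [IsProbabilityMeasure μ] {ν : Measure Ω'} [IsProbabilityMeasure ν]

/-- The variance of the function `a` under the weights `p`. -/
def weightedVar {ι : Type*} [Fintype ι] (p a : ι → ℝ) : ℝ :=
  ∑ x, p x * a x ^ 2 - (∑ x, p x * a x) ^ 2

lemma dotProduct_multinomialCov_mulVec {ι : Type*} [Fintype ι] [DecidableEq ι] (v x : ι → ℝ) :
    x ⬝ᵥ multinomialCov v *ᵥ x = weightedVar v x := by
  have hM : multinomialCov v = Matrix.diagonal v - Matrix.vecMulVec v v := by
    ext i j
    by_cases h : i = j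
    · subst h; simp [multinomialCov, Matrix.vecMulVec_apply]; ring
    · simp [multinomialCov, Matrix.vecMulVec_apply, h]
  rw [hM, Matrix.sub_mulVec, dotProduct_sub, weightedVar]
  congr 1
  · simp only [dotProduct, Matrix.mulVec_diagonal]
    exact Finset.sum_congr rfl (fun i _ => by ring)
  · rw [Matrix.vecMulVec_mulVec]
    simp only [dotProduct, sq, Finset.sum_mul]
    refine Finset.sum_congr rfl (fun i _ => ?_)
    simp
    ring

section Sample

variable {N : ℕ} {Z : ℕ → Ω → Fin (N + 1)} {p : Fin (N + 1) → ℝ}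

lemma integral_comp_sample (hZ : ∀ k, Measurable (Z k))
    (hlaw : ∀ k i, μ.real (Z k ⁻¹' {i}) = p i) (k : ℕ) (a : Fin (N + 1) → ℝ) :
    ∫ ω, a (Z k ω) ∂μ = ∑ x, p x * a x := by
  have := Measure.isProbabilityMeasure_map (hZ k).aemeasurable (μ := μ)
  rw [← integral_map (hZ k).aemeasurable (by fun_prop), integral_fintype .of_finite]
  refine Finset.sum_congr rfl fun x _ => ?_
  rw [map_measureReal_apply (hZ k) (measurableSet_singleton x), hlaw, smul_eq_mul]

lemma variance_comp_sample (hZ : ∀ k, Measurable (Z k))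
    (hlaw : ∀ k i, μ.real (Z k ⁻¹' {i}) = p i) (k : ℕ) (a : Fin (N + 1) → ℝ) :
    Var[fun ω => a (Z k ω); μ] = weightedVar p a := by
  have hm : Measurable fun ω => a (Z k ω) := (measurable_of_finite a).comp (hZ k)
  rw [variance_eq_sub, weightedVar]
  · congr 1
    · exact integral_comp_sample hZ hlaw k fun x => a x ^ 2
    · rw [integral_comp_sample hZ hlaw k a]
  · obtain ⟨C, hC⟩ := (Set.finite_range fun x => ‖a x‖).bddAbove
    exact MemLp.of_bound hm.aestronglyMeasurable C (ae_of_all _ fun ω => hC ⟨Z k ω, rfl⟩)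

lemma weightedVar_nonneg_of_sample (hZ : ∀ k, Measurable (Z k))
    (hlaw : ∀ k i, μ.real (Z k ⁻¹' {i}) = p i) (a : Fin (N + 1) → ℝ) : 0 ≤ weightedVar p a := by
  rw [← variance_comp_sample hZ hlaw 0 a]
  exact variance_nonneg _ _

/-- The normalised deviation of the sample sum of `a` from its mean. -/
def sampleDev (Z : ℕ → Ω → Fin (N + 1)) (p a : Fin (N + 1) → ℝ) (n : ℕ) (ω : Ω) : ℝ :=
  (√n)⁻¹ * (∑ k ∈ Finset.range n, a (Z k ω) - n * ∑ x, p x * a x)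

lemma measurable_sampleDev (hZ : ∀ k, Measurable (Z k)) (a : Fin (N + 1) → ℝ) (n : ℕ) :
    Measurable (sampleDev Z p a n) := by
  have : ∀ k, Measurable fun ω => a (Z k ω) := fun k => (measurable_of_finite a).comp (hZ k)
  unfold sampleDev
  fun_prop

lemma tendstoInDistribution_sampleDev (hZ : ∀ k, Measurable (Z k))
    (hlaw : ∀ k i, μ.real (Z k ⁻¹' {i}) = p i) (hind : iIndepFun Z μ) (a : Fin (N + 1) → ℝ) :
    TendstoInDistribution (sampleDev Z p a) atTop id (fun _ => μ)
      (gaussianReal 0 (weightedVar p a).toNNReal) := by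
  have hm : ∀ k, Measurable fun ω => a (Z k ω) := fun k => (measurable_of_finite a).comp (hZ k)
  have hid : ∀ k, IdentDistrib (Z k) (Z 0) μ μ := fun k => by
    refine ⟨(hZ k).aemeasurable, (hZ 0).aemeasurable, ?_⟩
    refine Measure.ext_of_singleton fun x => ?_
    rw [Measure.map_apply (hZ k) (measurableSet_singleton x),
      Measure.map_apply (hZ 0) (measurableSet_singleton x),
      ← measureReal_eq_measureReal_iff, hlaw, hlaw]
  have h := tendstoInDistribution_inv_sqrt_mul_sum_sub (P := μ) (X := fun k ω => a (Z k ω))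
    (Y := id) (P' := gaussianReal 0 (weightedVar p a).toNNReal)
    (by rw [variance_comp_sample hZ hlaw 0 a]; exact HasLaw.id) ?_
    (hind.comp (fun _ => a) fun _ => measurable_of_finite a)
    (fun k => (hid k).comp (measurable_of_finite a))
  · rw [integral_comp_sample hZ hlaw 0 a] at h
    exact h
  · obtain ⟨C, hC⟩ := (Set.finite_range fun x => ‖a x‖).bddAbove
    exact MemLp.of_bound (hm 0).aestronglyMeasurable C (ae_of_all _ fun ω => hC ⟨Z 0 ω, rfl⟩)

/-- Slutsky's theorem for the normalised sample sums with varying scale. -/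
lemma tendsto_charFun_scaled_sampleDev (hZ : ∀ k, Measurable (Z k))
    (hlaw : ∀ k i, μ.real (Z k ⁻¹' {i}) = p i) (hind : iIndepFun Z μ) (a : Fin (N + 1) → ℝ)
    {n : ℕ → ℕ} (hn : Tendsto n atTop atTop) {q : ℕ → ℝ} {q₀ : ℝ} (hq : Tendsto q atTop (𝓝 q₀)) :
    Tendsto (fun t => charFun (μ.map fun ω => q t * sampleDev Z p a (n t) ω) 1) atTop
      (𝓝 (Complex.exp (-(q₀ ^ 2 * weightedVar p a / 2 : ℝ)))) := by
  have h0 := tendstoInDistribution_sampleDev hZ hlaw hind a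
  have h1 : TendstoInDistribution (fun t => sampleDev Z p a (n t)) atTop id (fun _ => μ)
      (gaussianReal 0 (weightedVar p a).toNNReal) :=
    ⟨fun t => h0.forall_aemeasurable _, h0.aemeasurable_limit, h0.tendsto.comp hn⟩
  have h2 := h1.continuous_comp_prodMk_of_tendstoInMeasure_const (E' := ℝ)
    (g := fun z : ℝ × ℝ => z.2 * z.1) (by fun_prop) (Y := fun t _ => q t) (c := q₀)
    (tendstoInMeasure_of_tendsto_ae (fun _ => by fun_prop) (ae_of_all _ fun _ => hq))
    (fun _ => by fun_prop)
  have h3 := ProbabilityMeasure.tendsto_iff_tendsto_charFun.1 h2.tendsto 1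
  simp only [ProbabilityMeasure.coe_mk, id] at h3
  rw [charFun_map_mul, charFun_gaussianReal] at h3
  convert h3 using 2
  have := weightedVar_nonneg_of_sample (μ := μ) hZ hlaw a
  rw [Real.coe_toNNReal _ this]
  push_cast
  congr 1
  ring

lemma sum_mul_empirical_sub (a : Fin (N + 1) → ℝ) {n : ℕ} (hn : 0 < n) (ω : Ω) :
    ∑ x, a x * (empirical Z n ω x - p x) = (√n)⁻¹ * sampleDev Z p a n ω := by
  have hn' : (n : ℝ) ≠ 0 := by positivity
  have h1 : ∑ x, a x * empirical Z n ω x = (n : ℝ)⁻¹ * ∑ k ∈ Finset.range n, a (Z k ω) := by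
    simp only [empirical]
    simp_rw [mul_left_comm (a _), Finset.mul_sum (s := Finset.range n)]
    rw [Finset.sum_comm]
    refine Finset.sum_congr rfl fun k _ => ?_
    simp
  have h2 : (√n)⁻¹ * (√n)⁻¹ = (n : ℝ)⁻¹ := by
    rw [← mul_inv, Real.mul_self_sqrt (Nat.cast_nonneg n)]
  simp only [mul_sub, Finset.sum_sub_distrib, h1, sampleDev, ← mul_assoc]
  rw [h2, inv_mul_cancel₀ hn', one_mul]
  simp only [mul_comm]

end Sample

/-- The extension by zero of a function of the first `N` points. -/
def extendZero {N : ℕ} (u : Fin N → ℝ) : Fin (N + 1) → ℝ := Fin.snoc (α := fun _ => ℝ) u 0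

lemma sum_extendZero_mul {N : ℕ} (u : Fin N → ℝ) (f : Fin (N + 1) → ℝ) :
    ∑ x, extendZero u x * f x = ∑ i, u i * f i.castSucc := by
  rw [Fin.sum_univ_castSucc]
  simp [extendZero]

/-- A functional of `r_†` is a function on all points that vanishes at the last one, so the
quadratic form of `Σ(r_†)` is a genuine variance under `r`. -/
lemma weightedVar_extendZero {N : ℕ} (r : Fin (N + 1) → ℝ) (u : Fin N → ℝ) :
    weightedVar r (extendZero u) = weightedVar (dagger r) u := by
  simp [weightedVar, Fin.sum_univ_castSucc, extendZero, dagger]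

lemma rate_eq_sqrt_mul {n m : ℕ} : rate n m = √((m : ℝ) / (n + m)) * √n := by
  rw [rate, ← Real.sqrt_mul (by positivity)]
  congr 1
  ring

lemma rate_eq_sqrt_mul' {n m : ℕ} : rate n m = √((n : ℝ) / (n + m)) * √m := by
  rw [rate, ← Real.sqrt_mul (by positivity)]
  congr 1
  ring

lemma dotProduct_rate_smul {N : ℕ} {X Y : ℕ → Ω → Fin (N + 1)} {r s : Fin (N + 1) → ℝ}
    (u : Fin N ⊕ Fin (N + 1) → ℝ) {n m : ℕ} (hn : 0 < n) (hm : 0 < m) (ω : Ω) :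
    u ⬝ᵥ (rate n m • (reducedRhs (empirical X n ω) (empirical Y m ω) - reducedRhs r s)) =
      √((m : ℝ) / (n + m)) * sampleDev X r (extendZero (u ∘ Sum.inl)) n ω +
      √((n : ℝ) / (n + m)) * sampleDev Y s (u ∘ Sum.inr) m ω := by
  have h1 := sum_mul_empirical_sub (Z := X) (p := r) (extendZero (u ∘ Sum.inl)) hn ω
  have h2 := sum_mul_empirical_sub (Z := Y) (p := s) (u ∘ Sum.inr) hm ω
  rw [sum_extendZero_mul] at h1
  have hn' : √(n : ℝ) ≠ 0 := by positivity
  have hm' : √(m : ℝ) ≠ 0 := by positivity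
  rw [dotProduct_smul, smul_eq_mul, dotProduct, Fintype.sum_sum_type, mul_add]
  congr 1
  · rw [rate_eq_sqrt_mul, mul_assoc]
    congr 1
    rw [← mul_inv_cancel_left₀ hn' (sampleDev _ _ _ _ _), ← h1]
    rfl
  · rw [rate_eq_sqrt_mul', mul_assoc]
    congr 1
    rw [← mul_inv_cancel_left₀ hm' (sampleDev _ _ _ _ _), ← h2]
    rfl

/-- The two sums depend on disjoint finite blocks of one independent family. -/
lemma indepFun_of_sums {N : ℕ} {X Y : ℕ → Ω → Fin (N + 1)} (hX : ∀ k, Measurable (X k))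
    (hY : ∀ k, Measurable (Y k)) (hindep : iIndepFun (Sum.elim X Y) μ) (a b p q : Fin (N + 1) → ℝ)
    (n m : ℕ) : IndepFun (sampleDev X p a n) (sampleDev Y q b m) μ := by
  classical
  have hmeas : ∀ i, Measurable (Sum.elim X Y i) := by rintro (k | k); exacts [hX k, hY k]
  have h := hindep.indepFun_finset ((Finset.range n).map .inl) ((Finset.range m).map .inr)
    (Finset.disjoint_map_inl_map_inr _ _) hmeas
  have hc := h.comp
    (φ := fun z => (√n)⁻¹ * (∑ k : Finset.range n,
      a (z ⟨.inl k, by simpa using Finset.mem_range.1 k.2⟩) - n * ∑ x, p x * a x))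
    (ψ := fun z => (√m)⁻¹ * (∑ k : Finset.range m,
      b (z ⟨.inr k, by simpa using Finset.mem_range.1 k.2⟩) - m * ∑ x, q x * b x))
    (measurable_of_finite _) (measurable_of_finite _)
  convert hc using 1
  · funext ω
    simp only [sampleDev, Function.comp, Sum.elim_inl]
    rw [Finset.sum_coe_sort (Finset.range n) fun k => a (X k ω)]
  · funext ω
    simp only [sampleDev, Function.comp, Sum.elim_inr]
    rw [Finset.sum_coe_sort (Finset.range m) fun k => b (Y k ω)]

/-! ### The Gaussian limit and its nondegeneracy. -/

section Gaussian

variable {N : ℕ} {r s : Fin (N + 1) → ℝ} {G₁ : Ω' → EuclideanSpace ℝ (Fin N)}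
  {G₂ : Ω' → EuclideanSpace ℝ (Fin (N + 1))} {lam : ℝ}

lemma posSemidef_dagger (hr : r ∈ riSimplex (Fin (N + 1))) :
    (multinomialCov (dagger r)).PosSemidef := by
  refine multinomialCov_posSemidef _ (fun _ => (hr.2 _).le) ?_
  have := hr.1
  rw [Fin.sum_univ_castSucc] at this
  have h0 := (hr.2 (Fin.last N)).le
  simp only [dagger]
  linarith

lemma posSemidef_full (hs : s ∈ riSimplex (Fin (N + 1))) : (multinomialCov s).PosSemidef :=
  multinomialCov_posSemidef _ (fun _ => (hs.2 _).le) hs.1.le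

lemma charFun_dotProduct_gaussianLimit {ι : Type*} [Fintype ι] [DecidableEq ι] {v : ι → ℝ}
    (hv : (multinomialCov v).PosSemidef) {G : Ω' → EuclideanSpace ℝ ι}
    (hG : HasLaw G (gaussianLimit v) ν) (x : ι → ℝ) (τ : ℝ) :
    charFun (ν.map fun ω => x ⬝ᵥ (G ω).ofLp) τ = Complex.exp (-(τ ^ 2 * weightedVar v x / 2 : ℝ)) := by
  have h1 := charFun_multivariateGaussian (μ := 0) hv (WithLp.toLp 2 (τ • x))
  change charFun (gaussianLimit v) _ = _ at h1
  have hm : AEMeasurable (fun ω => x ⬝ᵥ (G ω).ofLp) ν :=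
    (show Continuous fun g : EuclideanSpace ℝ ι => x ⬝ᵥ g.ofLp by fun_prop).measurable.comp_aemeasurable
      hG.aemeasurable
  rw [← hG.map_eq, charFun_apply, integral_map hG.aemeasurable (by fun_prop)] at h1
  rw [charFun_apply, integral_map hm (by fun_prop)]
  have h2 : ∀ ω, (inner ℝ (x ⬝ᵥ (G ω).ofLp) τ : ℝ) = inner ℝ (G ω) (WithLp.toLp 2 (τ • x)) := by
    intro ω
    simp [EuclideanSpace.inner_eq_star_dotProduct]
  simp only [h2]
  rw [h1]
  congr 1
  rw [inner_zero_right]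
  simp only [Matrix.mulVec_smul, smul_dotProduct, dotProduct_smul, dotProduct_multinomialCov_mulVec]
  push_cast
  simp
  ring

lemma aemeasurable_gaussPair (hG₁ : AEMeasurable G₁ ν) (hG₂ : AEMeasurable G₂ ν) :
    AEMeasurable (fun ω => gaussPair lam (G₁ ω) (G₂ ω)) ν := by
  refine aemeasurable_pi_lambda _ ?_
  rintro (i | j)
  · exact (show Continuous fun g : EuclideanSpace ℝ (Fin N) => √lam * g i by
      fun_prop).measurable.comp_aemeasurable hG₁
  · exact (show Continuous fun g : EuclideanSpace ℝ (Fin (N + 1)) => √(1 - lam) * g j by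
      fun_prop).measurable.comp_aemeasurable hG₂

/-- The variance of the linear functional `u` of the Gaussian limit. -/
def limitVar (lam : ℝ) (r s : Fin (N + 1) → ℝ) (u : Fin N ⊕ Fin (N + 1) → ℝ) : ℝ :=
  lam * weightedVar (dagger r) (u ∘ Sum.inl) + (1 - lam) * weightedVar s (u ∘ Sum.inr)

lemma charFun_dotProduct_gaussPair (hr : r ∈ riSimplex (Fin (N + 1)))
    (hs : s ∈ riSimplex (Fin (N + 1))) (hlam : lam ∈ Set.Ioo (0 : ℝ) 1)
    (hG₁ : HasLaw G₁ (gaussianLimit (dagger r)) ν) (hG₂ : HasLaw G₂ (gaussianLimit s) ν)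
    (hG : IndepFun G₁ G₂ ν) (u : Fin N ⊕ Fin (N + 1) → ℝ) (τ : ℝ) :
    charFun (ν.map fun ω => u ⬝ᵥ gaussPair lam (G₁ ω) (G₂ ω)) τ =
      Complex.exp (-(τ ^ 2 * limitVar lam r s u / 2 : ℝ)) := by
  have e : ∀ ω, u ⬝ᵥ gaussPair lam (G₁ ω) (G₂ ω) =
      √lam * ((u ∘ Sum.inl) ⬝ᵥ (G₁ ω).ofLp) + √(1 - lam) * ((u ∘ Sum.inr) ⬝ᵥ (G₂ ω).ofLp) := by
    intro ω
    simp only [dotProduct, Fintype.sum_sum_type, gaussPair, Sum.elim_inl, Sum.elim_inr,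
      Finset.mul_sum, Function.comp]
    congr 1 <;> exact Finset.sum_congr rfl fun _ _ => by ring
  have c₁ : Continuous fun g : EuclideanSpace ℝ (Fin N) => (u ∘ Sum.inl) ⬝ᵥ g.ofLp := by fun_prop
  have c₂ : Continuous fun g : EuclideanSpace ℝ (Fin (N + 1)) => (u ∘ Sum.inr) ⬝ᵥ g.ofLp := by
    fun_prop
  have m₁ := c₁.measurable.comp_aemeasurable hG₁.aemeasurable
  have m₂ := c₂.measurable.comp_aemeasurable hG₂.aemeasurable
  have hi := hG.comp (c₁.measurable.const_mul √lam) (c₂.measurable.const_mul √(1 - lam))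
  simp only [e]
  have hmul := hi.charFun_map_fun_add_eq_mul (m₁.const_mul _) (m₂.const_mul _)
  simp only [Function.comp_apply] at hmul
  rw [hmul, Pi.mul_apply]
  simp only [Function.comp_def] at m₁ m₂
  have q₁ := charFun_map_mul_comp m₁ √lam τ
  have q₂ := charFun_map_mul_comp m₂ √(1 - lam) τ
  rw [show (u ∘ Sum.inl) = fun i => u (Sum.inl i) from rfl,
    show (u ∘ Sum.inr) = fun i => u (Sum.inr i) from rfl]
  rw [q₁, q₂]
  rw [charFun_dotProduct_gaussianLimit (posSemidef_dagger hr) hG₁,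
    charFun_dotProduct_gaussianLimit (posSemidef_full hs) hG₂, ← Complex.exp_add, mul_pow, mul_pow,
    Real.sq_sqrt hlam.1.le, Real.sq_sqrt (by linarith [hlam.2])]
  congr 1
  simp only [limitVar, Function.comp_def]
  push_cast
  ring

end Gaussian

variable {N : ℕ} {r s : Fin (N + 1) → ℝ} {G₁ : Ω' → EuclideanSpace ℝ (Fin N)}
  {G₂ : Ω' → EuclideanSpace ℝ (Fin (N + 1))} {lam : ℝ}

lemma weightedVar_eq_sum_sq {ι : Type*} [Fintype ι] {p : ι → ℝ} (hp : ∑ x, p x = 1) (a : ι → ℝ) :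
    weightedVar p a = ∑ x, p x * (a x - ∑ y, p y * a y) ^ 2 := by
  set M := ∑ y, p y * a y with hM
  have : ∀ x, p x * (a x - M) ^ 2 = p x * a x ^ 2 - 2 * M * (p x * a x) + M ^ 2 * p x := by
    intro x; ring
  simp only [this, Finset.sum_add_distrib, Finset.sum_sub_distrib, ← Finset.mul_sum, hp, ← hM]
  rw [weightedVar, ← hM]
  ring

lemma weightedVar_nonneg {ι : Type*} [Fintype ι] {p : ι → ℝ} (hp : p ∈ riSimplex ι) (a : ι → ℝ) :
    0 ≤ weightedVar p a := by
  rw [weightedVar_eq_sum_sq hp.1]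
  exact Finset.sum_nonneg fun x _ => mul_nonneg (hp.2 x).le (sq_nonneg _)

lemma eq_mean_of_weightedVar_eq_zero {ι : Type*} [Fintype ι] {p : ι → ℝ} (hp : p ∈ riSimplex ι)
    {a : ι → ℝ} (h : weightedVar p a = 0) (x : ι) : a x = ∑ y, p y * a y := by
  rw [weightedVar_eq_sum_sq hp.1,
    Finset.sum_eq_zero_iff_of_nonneg fun x _ => mul_nonneg (hp.2 x).le (sq_nonneg _)] at h
  have := (mul_eq_zero.1 (h x (Finset.mem_univ x))).resolve_left (hp.2 x).ne'
  exact sub_eq_zero.1 (pow_eq_zero_iff two_ne_zero |>.1 this)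

/-- Zero variance under strictly positive weights makes each block constant. The first block,
extended by zero at the last point, is then zero; the constant of the second equals `u ⬝ᵥ (r_†, s)`
because `s` has sum one, and this is zero by assumption. -/
lemma limitVar_pos (hr : r ∈ riSimplex (Fin (N + 1))) (hs : s ∈ riSimplex (Fin (N + 1)))
    (hlam : lam ∈ Set.Ioo (0 : ℝ) 1) {u : Fin N ⊕ Fin (N + 1) → ℝ} (hu : u ≠ 0)
    (hu0 : u ⬝ᵥ reducedRhs r s = 0) : 0 < limitVar lam r s u := by
  have h1 := weightedVar_nonneg hr (extendZero (u ∘ Sum.inl))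
  have h2 := weightedVar_nonneg hs (u ∘ Sum.inr)
  have hl : 0 < 1 - lam := by linarith [hlam.2]
  rw [limitVar, ← weightedVar_extendZero]
  refine lt_of_le_of_ne (add_nonneg (mul_nonneg hlam.1.le h1) (mul_nonneg hl.le h2)) fun h => hu ?_
  have h1' : weightedVar r (extendZero (u ∘ Sum.inl)) = 0 := by
    by_contra hne
    have := mul_pos hlam.1 (lt_of_le_of_ne h1 (Ne.symm hne))
    have := mul_nonneg hl.le h2
    linarith
  have h2' : weightedVar s (u ∘ Sum.inr) = 0 := by
    rw [h1', mul_zero, zero_add] at h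
    exact (mul_eq_zero.1 h.symm).resolve_left hl.ne'
  have e1 := eq_mean_of_weightedVar_eq_zero hr h1'
  have e2 := eq_mean_of_weightedVar_eq_zero hs h2'
  have hinl : ∀ i, u (Sum.inl i) = 0 := by
    intro i
    have := (e1 i.castSucc).trans (e1 (Fin.last N)).symm
    simpa [extendZero] using this
  have hinr : ∀ j, u (Sum.inr j) = 0 := by
    intro j
    have := e2 j
    simp only [Function.comp] at this
    rw [this]
    simpa [dotProduct, reducedRhs, hinl, mul_comm] using hu0
  funext i
  rcases i with i | j
  exacts [hinl i, hinr j]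

lemma hasLaw_dotProduct_gaussPair (hr : r ∈ riSimplex (Fin (N + 1)))
    (hs : s ∈ riSimplex (Fin (N + 1))) (hlam : lam ∈ Set.Ioo (0 : ℝ) 1)
    (hG₁ : HasLaw G₁ (gaussianLimit (dagger r)) ν) (hG₂ : HasLaw G₂ (gaussianLimit s) ν)
    (hG : IndepFun G₁ G₂ ν) {u : Fin N ⊕ Fin (N + 1) → ℝ} (hu : 0 ≤ limitVar lam r s u) :
    HasLaw (fun ω => u ⬝ᵥ gaussPair lam (G₁ ω) (G₂ ω))
      (gaussianReal 0 (limitVar lam r s u).toNNReal) ν := by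
  have hm : AEMeasurable (fun ω => u ⬝ᵥ gaussPair lam (G₁ ω) (G₂ ω)) ν :=
    (show Continuous fun v : Fin N ⊕ Fin (N + 1) → ℝ => u ⬝ᵥ v by
      fun_prop).measurable.comp_aemeasurable (aemeasurable_gaussPair hG₁.aemeasurable hG₂.aemeasurable)
  refine ⟨hm, ?_⟩
  have := Measure.isProbabilityMeasure_map (μ := ν) hm
  refine Measure.ext_of_charFun ?_
  funext τ
  rw [charFun_dotProduct_gaussPair hr hs hlam hG₁ hG₂ hG, charFun_gaussianReal,
    Real.coe_toNNReal _ hu]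
  congr 1
  push_cast
  ring

/-- A nonzero linear functional vanishing at the marginals is almost surely nonzero at the
Gaussian limit. -/
theorem ae_linearMap_gaussPair_ne_zero (hr : r ∈ riSimplex (Fin (N + 1)))
    (hs : s ∈ riSimplex (Fin (N + 1))) (hlam : lam ∈ Set.Ioo (0 : ℝ) 1)
    (hG₁ : HasLaw G₁ (gaussianLimit (dagger r)) ν) (hG₂ : HasLaw G₂ (gaussianLimit s) ν)
    (hG : IndepFun G₁ G₂ ν) {f : (Fin N ⊕ Fin (N + 1) → ℝ) →ₗ[ℝ] ℝ} (hf : f ≠ 0)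
    (hf0 : f (reducedRhs r s) = 0) : ∀ᵐ ω ∂ν, f (gaussPair lam (G₁ ω) (G₂ ω)) ≠ 0 := by
  classical
  set u : Fin N ⊕ Fin (N + 1) → ℝ := fun i => f (Pi.single i 1) with hu
  have hfu : ∀ v, f v = u ⬝ᵥ v := by
    intro v
    rw [f.pi_apply_eq_sum_univ v]
    refine Finset.sum_congr rfl fun i _ => ?_
    rw [smul_eq_mul, mul_comm, hu]
    congr 2
    funext j
    simp [Pi.single_apply, eq_comm]
  have hpos := limitVar_pos hr hs hlam (u := u) (fun h => hf (LinearMap.ext fun v => by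
    rw [hfu, h]; simp)) (by rw [← hfu]; exact hf0)
  have hlaw := hasLaw_dotProduct_gaussPair hr hs hlam hG₁ hG₂ hG hpos.le
  have := nullSingletonClass_gaussianReal (μ := 0) (v := (limitVar lam r s u).toNNReal) (by simpa using hpos)
  have hae : ∀ᵐ x ∂gaussianReal 0 (limitVar lam r s u).toNNReal, x ≠ 0 := by
    simp [ae_iff]
  rw [← hlaw.map_eq] at hae
  filter_upwards [ae_of_ae_map hlaw.aemeasurable hae] with ω h
  rw [hfu]
  exact h

/-- A proper subspace lies in the kernel of a nonzero functional, which vanishes at the marginals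
along with the subspace. -/
lemma ae_gaussPair_notMem_submodule (hr : r ∈ riSimplex (Fin (N + 1)))
    (hs : s ∈ riSimplex (Fin (N + 1))) (hlam : lam ∈ Set.Ioo (0 : ℝ) 1)
    (hG₁ : HasLaw G₁ (gaussianLimit (dagger r)) ν) (hG₂ : HasLaw G₂ (gaussianLimit s) ν)
    (hG : IndepFun G₁ G₂ ν) {S : Submodule ℝ (Fin N ⊕ Fin (N + 1) → ℝ)} (hS : S ≠ ⊤)
    (hS0 : reducedRhs r s ∈ S) : ∀ᵐ ω ∂ν, gaussPair lam (G₁ ω) (G₂ ω) ∉ S := by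
  obtain ⟨f, hf, hle⟩ := S.exists_le_ker_of_lt_top (lt_top_iff_ne_top.2 hS)
  filter_upwards [ae_linearMap_gaussPair_ne_zero hr hs hlam hG₁ hG₂ hG hf (hle hS0)] with ω h hmem
  exact h (hle hmem)

lemma measurable_empirical {Z : ℕ → Ω → Fin (N + 1)} (hZ : ∀ k, Measurable (Z k)) (n : ℕ) :
    Measurable (empirical Z n) := by
  refine measurable_pi_lambda _ fun i => ?_
  have : ∀ k, Measurable fun ω => if Z k ω = i then (1 : ℝ) else 0 := fun k =>
    (measurable_of_finite fun x : Fin (N + 1) => if x = i then (1 : ℝ) else 0).comp (hZ k)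
  unfold empirical
  fun_prop

lemma measurable_reducedRhs_empirical {X Y : ℕ → Ω → Fin (N + 1)} (hX : ∀ k, Measurable (X k))
    (hY : ∀ k, Measurable (Y k)) (n m : ℕ) :
    Measurable fun ω => reducedRhs (empirical X n ω) (empirical Y m ω) := by
  refine measurable_pi_lambda _ ?_
  rintro (i | j)
  · exact (measurable_pi_apply i.castSucc).comp (measurable_empirical hX n)
  · exact (measurable_pi_apply j).comp (measurable_empirical hY m)

/-! ### Joint central limit theorem, localisation and compactness. -/

section CentralLimit

variable {X Y : ℕ → Ω → Fin (N + 1)} {n m : ℕ → ℕ}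

/-- The central limit theorem for the pair of empirical marginals. -/
theorem tendstoInDistribution_rate_smul (hr : r ∈ riSimplex (Fin (N + 1)))
    (hs : s ∈ riSimplex (Fin (N + 1))) (hX : ∀ k, Measurable (X k)) (hY : ∀ k, Measurable (Y k))
    (hXlaw : ∀ k i, μ.real (X k ⁻¹' {i}) = r i) (hYlaw : ∀ k i, μ.real (Y k ⁻¹' {i}) = s i)
    (hindep : iIndepFun (Sum.elim X Y) μ) (hnpos : ∀ t, 0 < n t) (hmpos : ∀ t, 0 < m t)
    (hn : Tendsto n atTop atTop) (hm : Tendsto m atTop atTop) (hlam : lam ∈ Set.Ioo (0 : ℝ) 1)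
    (hratio : Tendsto (fun t => (m t : ℝ) / (n t + m t)) atTop (𝓝 lam))
    (hG₁ : HasLaw G₁ (gaussianLimit (dagger r)) ν) (hG₂ : HasLaw G₂ (gaussianLimit s) ν)
    (hG : IndepFun G₁ G₂ ν) :
    TendstoInDistribution (fun t ω => rate (n t) (m t) •
      (reducedRhs (empirical X (n t) ω) (empirical Y (m t) ω) - reducedRhs r s)) atTop
      (fun ω => gaussPair lam (G₁ ω) (G₂ ω)) (fun _ => μ) ν := by
  refine tendstoInDistribution_of_charFun_dotProduct
    (fun t => (((measurable_reducedRhs_empirical hX hY (n t) (m t)).sub_const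
      (reducedRhs r s)).const_smul (rate (n t) (m t))).aemeasurable)
    (aemeasurable_gaussPair hG₁.aemeasurable hG₂.aemeasurable) fun u => ?_
  rw [charFun_dotProduct_gaussPair hr hs hlam hG₁ hG₂ hG]
  have hq₁ : Tendsto (fun t => √((m t : ℝ) / (n t + m t))) atTop (𝓝 √lam) :=
    (Real.continuous_sqrt.tendsto lam).comp hratio
  have hq₂ : Tendsto (fun t => √((n t : ℝ) / (n t + m t))) atTop (𝓝 √(1 - lam)) := by
    refine (Real.continuous_sqrt.tendsto (1 - lam)).comp ((hratio.const_sub 1).congr fun t => ?_)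
    have : (n t : ℝ) + m t ≠ 0 := by have := hnpos t; positivity
    field_simp
    ring
  have hXi : iIndepFun X μ := iIndepFun.precomp (f := Sum.elim X Y) Sum.inl_injective hindep
  have hYi : iIndepFun Y μ := iIndepFun.precomp (f := Sum.elim X Y) Sum.inr_injective hindep
  have l₁ := tendsto_charFun_scaled_sampleDev hX hXlaw hXi (extendZero (u ∘ Sum.inl)) hn hq₁
  have l₂ := tendsto_charFun_scaled_sampleDev hY hYlaw hYi (u ∘ Sum.inr) hm hq₂
  rw [Real.sq_sqrt hlam.1.le, weightedVar_extendZero] at l₁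
  rw [Real.sq_sqrt (by linarith [hlam.2])] at l₂
  have hl := l₁.mul l₂
  rw [← Complex.exp_add] at hl
  convert hl using 1
  · funext t
    simp only [dotProduct_rate_smul u (hnpos t) (hmpos t)]
    have m₁ := measurable_sampleDev (p := r) hX (extendZero (u ∘ Sum.inl)) (n t)
    have m₂ := measurable_sampleDev (p := s) hY (u ∘ Sum.inr) (m t)
    have hi := (indepFun_of_sums hX hY hindep (extendZero (u ∘ Sum.inl)) (u ∘ Sum.inr) r s
      (n t) (m t)).comp (measurable_const_mul √((m t : ℝ) / (n t + m t)))
      (measurable_const_mul √((n t : ℝ) / (n t + m t)))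
    have := hi.charFun_map_fun_add_eq_mul (m₁.const_mul _).aemeasurable (m₂.const_mul _).aemeasurable
    exact congrFun this 1
  · congr 2
    simp only [limitVar]
    push_cast
    ring

lemma tendsto_rate (hn : Tendsto n atTop atTop)
    (hlam : lam ∈ Set.Ioo (0 : ℝ) 1)
    (hratio : Tendsto (fun t => (m t : ℝ) / (n t + m t)) atTop (𝓝 lam)) :
    Tendsto (fun t => rate (n t) (m t)) atTop atTop := by
  refine Real.tendsto_sqrt_atTop.comp ?_
  refine (((tendsto_natCast_atTop_atTop (R := ℝ)).comp hn).atTop_mul_pos hlam.1 hratio).congr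
    fun t => ?_
  simp only [Function.comp]
  ring

end CentralLimit

/-- If rescaled deviations converge in distribution, then the deviations are asymptotically in any
neighbourhood. -/
lemma tendsto_measure_notMem_nhds {ι : Type*} [Fintype ι] {b : ℕ → Ω → ι → ℝ} {b₀ : ι → ℝ}
    {ρ : ℕ → ℝ} (hρ : Tendsto ρ atTop atTop) (hρpos : ∀ t, 0 < ρ t) {Z : Ω' → ι → ℝ}
    (h : TendstoInDistribution (fun t ω => ρ t • (b t ω - b₀)) atTop Z (fun _ => μ) ν)
    {U : Set (ι → ℝ)} (hU : U ∈ 𝓝 b₀) : Tendsto (fun t => μ {ω | b t ω ∉ U}) atTop (𝓝 0) := by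
  obtain ⟨V, hVU, hVo, hbV⟩ := mem_nhds_iff.1 hU
  -- Slutsky with the factor `ρ⁻¹ → 0`: undoing the rescaling gives convergence to the constant
  -- `b₀`.
  have h2 := h.continuous_comp_prodMk_of_tendstoInMeasure_const (E' := ℝ)
    (g := fun z : (ι → ℝ) × ℝ => b₀ + z.2 • z.1) (by fun_prop) (Y := fun t _ => (ρ t)⁻¹) (c := 0)
    (tendstoInMeasure_of_tendsto_ae (fun _ => by fun_prop)
      (ae_of_all _ fun _ => tendsto_inv_atTop_zero.comp hρ)) (fun _ => by fun_prop)
  have h3 := h2.tendsto_measure_closed_zero hVo.isClosed_compl (by simp [hbV])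
  refine tendsto_of_tendsto_of_tendsto_of_le_of_le tendsto_const_nhds h3 (fun _ => zero_le) fun t => ?_
  refine measure_mono fun ω hω => ?_
  simp only [Set.mem_ofPred_eq, Set.mem_compl_iff, smul_smul, inv_mul_cancel₀ (hρpos t).ne', one_smul,
    add_sub_cancel]
  exact fun hV => hω (hVU hV)

/-- Each entry of a nonnegative solution is at most its column sum, so the optimal set is a closed
subset of a box. -/
lemma isCompact_optSet (c : Fin (N + 1) × Fin (N + 1) → ℝ) (b : Fin N ⊕ Fin (N + 1) → ℝ) :
    IsCompact (LP.optSet (reducedMatrix N) c b) := by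
  refine (isCompact_Icc (a := (0 : Fin (N + 1) × Fin (N + 1) → ℝ))
    (b := fun p => b (Sum.inr p.2))).of_isClosed_subset (LP.isClosed_optSet _ _ _) fun x hx => ?_
  refine ⟨hx.1.2, fun p => ?_⟩
  have h := congrFun hx.1.1 (Sum.inr p.2)
  have h1 : reducedMatrix N (Sum.inr p.2) p * x p ≤ (reducedMatrix N *ᵥ x) (Sum.inr p.2) :=
    Finset.single_le_sum (f := fun q => reducedMatrix N (Sum.inr p.2) q * x q) (fun q _ => by
      refine mul_nonneg ?_ (hx.1.2 q)
      simp only [reducedMatrix]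
      split_ifs <;> norm_num) (Finset.mem_univ p)
  rw [h] at h1
  simpa [reducedMatrix] using h1

end OT

/-! ### Cells of cones and the limit maps. -/

namespace LP

variable {ι κ : Type*} [Fintype ι] [Fintype κ] {A : Matrix ι κ ℝ} {c : κ → ℝ} {b b₀ : ι → ℝ}
  {K : ℕ} {I : Fin K → Finset κ} {xstar : κ → ℝ}

/-- A closed set which contains a cell of cones and differs from it by a set contained in finitely
many hyperplanes. -/
def closedCell (A : Matrix ι κ ℝ) (xstar : κ → ℝ) {K : ℕ} (I : Fin K → Finset κ)
    (𝒦 : Finset (Fin K)) : Set (ι → ℝ) :=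
  {v | (∀ k ∈ 𝒦, v ∈ cone A xstar (I k)) ∧
    ∀ k ∉ 𝒦, ∃ j ∈ I k, xstar j = 0 ∧ primalBasic A (I k) v j ≤ 0}

lemma isClosed_cone {J : Finset κ} (hJ : IsBasis A J) (xstar : κ → ℝ) :
    IsClosed (cone A xstar J) := by
  have : cone A xstar J = ⋂ j ∈ J, ⋂ _ : xstar j = 0, {v | 0 ≤ primalBasic A J v j} := by
    ext v; simp [cone]
  rw [this]
  exact isClosed_biInter fun j _ => isClosed_iInter fun _ => isClosed_le continuous_const
    ((continuous_apply j).comp hJ.continuous_primalBasic)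

lemma isClosed_closedCell (hI : ∀ k, IsBasis A (I k)) (xstar : κ → ℝ) (𝒦 : Finset (Fin K)) :
    IsClosed (closedCell A xstar I 𝒦) := by
  have : closedCell A xstar I 𝒦 = (⋂ k ∈ 𝒦, cone A xstar (I k)) ∩
      ⋂ k ∉ 𝒦, ⋃ j ∈ {j | j ∈ I k ∧ xstar j = 0}, {v | primalBasic A (I k) v j ≤ 0} := by
    ext v; simp [closedCell, and_assoc]
  rw [this]
  refine (isClosed_biInter fun k _ => isClosed_cone (hI k) xstar).inter
    (isClosed_biInter fun k _ => ?_)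
  exact (Set.toFinite _).isClosed_biUnion fun j _ => isClosed_le
    ((continuous_apply j).comp (hI k).continuous_primalBasic) continuous_const

lemma measurableSet_coneCell (hI : ∀ k, IsBasis A (I k)) (xstar : κ → ℝ) (𝒦 : Finset (Fin K)) :
    MeasurableSet (coneCell (fun k => cone A xstar (I k)) 𝒦) := by
  have h : ∀ k, MeasurableSet (cone A xstar (I k)) := fun k =>
    (isClosed_cone (hI k) xstar).measurableSet
  refine MeasurableSet.diff ?_ ?_
  · exact MeasurableSet.iInter fun k => MeasurableSet.iInter fun _ => h k
  · exact MeasurableSet.iUnion fun k => MeasurableSet.iUnion fun _ => h k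

lemma mem_coneCell_of_mem_closedCell {v : ι → ℝ} {𝒦 : Finset (Fin K)}
    (hv : ∀ k, ∀ j ∈ I k, xstar j = 0 → primalBasic A (I k) v j ≠ 0)
    (h : v ∈ closedCell A xstar I 𝒦) : v ∈ coneCell (fun k => cone A xstar (I k)) 𝒦 := by
  refine ⟨by simpa using h.1, ?_⟩
  simp only [Set.mem_iUnion, not_exists]
  intro k hk hmem
  obtain ⟨j, hj, h0, hle⟩ := h.2 k hk
  exact hv k j hj h0 (le_antisymm hle (hmem j hj h0))

/-- A point of a cell determines the index set, as the set of all `k` whose `H k` contains the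
point. -/
lemma coneCell_unique {H : Fin K → Set (ι → ℝ)} {v : ι → ℝ} {𝒦 𝒦' : Finset (Fin K)}
    (h : v ∈ coneCell H 𝒦) (h' : v ∈ coneCell H 𝒦') : 𝒦 = 𝒦' := by
  have key : ∀ {𝒦 : Finset (Fin K)}, v ∈ coneCell H 𝒦 → ∀ k, k ∈ 𝒦 ↔ v ∈ H k := by
    intro 𝒦 h k
    have h1 := h.1
    have h2 := h.2
    simp only [Set.mem_iInter] at h1
    simp only [Set.mem_iUnion, not_exists] at h2
    exact ⟨h1 k, fun hv => by_contra fun hk => h2 k hk hv⟩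
  ext k
  rw [key h, key h']

lemma limitMap_eq_mix (α : (𝒦 : Finset (Fin K)) → (𝒦 → ℝ)) {v : ι → ℝ} {𝒦 : Finset (Fin K)}
    (h𝒦 : 𝒦.Nonempty) (h : v ∈ coneCell (fun k => cone A xstar (I k)) 𝒦) :
    limitMap A xstar I α v = mix A I 𝒦 (α 𝒦) v := by
  rw [limitMap, Finset.sum_eq_single 𝒦]
  · rw [Set.indicator_of_mem h]
  · intro 𝒦' _ hne
    exact Set.indicator_of_notMem (fun h' => hne (coneCell_unique h' h)) _
  · simp [h𝒦]

lemma limitMapSingle_eq_primalBasic {v : ι → ℝ} {k : Fin K} (h : v ∈ cone A xstar (I k))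
    (huniq : ∀ j, v ∈ cone A xstar (I j) → j = k) :
    limitMapSingle A xstar I v = primalBasic A (I k) v := by
  rw [limitMapSingle, Finset.sum_eq_single k]
  · have hmem : v ∈ cone A xstar (I k) \ ⋃ j < k, cone A xstar (I j) := by
      refine ⟨h, ?_⟩
      simp only [Set.mem_iUnion, not_exists]
      exact fun j hj hmem => hj.ne (huniq j hmem)
    exact Set.indicator_of_mem hmem _
  · intro j _ hne
    exact Set.indicator_of_notMem (fun h' => hne (huniq j h'.1)) _
  · simp

lemma continuous_mix (hI : ∀ k, IsBasis A (I k)) (𝒦 : Finset (Fin K)) :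
    Continuous fun z : (𝒦 → ℝ) × (ι → ℝ) => mix A I 𝒦 z.1 z.2 := by
  unfold mix
  refine continuous_finsetSum _ fun k _ => ?_
  exact ((continuous_apply k).comp continuous_fst).smul
    ((hI k).continuous_primalBasic.comp continuous_snd)

lemma measurable_limitMapSingle (hI : ∀ k, IsBasis A (I k)) (xstar : κ → ℝ) :
    Measurable (limitMapSingle A xstar I) := by
  have h : ∀ k, MeasurableSet (cone A xstar (I k)) := fun k =>
    (isClosed_cone (hI k) xstar).measurableSet
  unfold limitMapSingle
  refine Finset.measurable_sum _ fun k _ => ?_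
  refine (hI k).continuous_primalBasic.measurable.indicator ((h k).diff ?_)
  exact MeasurableSet.iUnion fun j => MeasurableSet.iUnion fun _ => h j

lemma aemeasurable_limitMap {Ω' : Type*} [MeasurableSpace Ω'] {ν : Measure Ω'}
    (hI : ∀ k, IsBasis A (I k)) (xstar : κ → ℝ) {α : (𝒦 : Finset (Fin K)) → Ω' → (𝒦 → ℝ)}
    {G : Ω' → ι → ℝ} (hα : ∀ 𝒦 : Finset (Fin K), 𝒦.Nonempty → AEMeasurable (α 𝒦) ν)
    (hG : AEMeasurable G ν) :
    AEMeasurable (fun ω => limitMap A xstar I (fun 𝒦 => α 𝒦 ω) (G ω)) ν := by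
  unfold limitMap
  refine Finset.aemeasurable_fun_sum _ fun 𝒦 h𝒦 => ?_
  have hm : AEMeasurable (fun ω => mix A I 𝒦 (α 𝒦 ω) (G ω)) ν :=
    (continuous_mix hI 𝒦).measurable.comp_aemeasurable
      ((hα 𝒦 (by simpa using h𝒦)).prodMk hG)
  have := hm.indicator₀ (hG.nullMeasurableSet_preimage (measurableSet_coneCell hI xstar 𝒦))
  exact this

/-- The functional `v ↦ x(I, v)_j` does not vanish for `j ∈ I`. -/
lemma IsBasis.proj_comp_primalBasicLin_ne_zero {J : Finset κ} (hJ : IsBasis A J) {j : κ}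
    (hj : j ∈ J) : LinearMap.proj j ∘ₗ primalBasicLin hJ ≠ (0 : (ι → ℝ) →ₗ[ℝ] ℝ) := by
  classical
  intro h
  have h1 := LinearMap.congr_fun h (A *ᵥ Pi.single j 1)
  have h2 : primalBasic A J (A *ᵥ Pi.single j 1) = Pi.single j 1 := by
    refine (primalBasic_eq_iff hJ _ _).2 ⟨rfl, fun i hi => Pi.single_eq_of_ne ?_ _⟩
    rintro rfl
    exact hi hj
  rw [LinearMap.comp_apply, primalBasicLin_apply, h2] at h1
  simp at h1

lemma smul_primalBasic_sub (hunique : optSet A c b₀ = {xstar})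
    (hI : Set.range I = {J | IsPrimalDualFeasibleBasis A c b₀ J})
    (k : Fin K) {ρ : ℝ} (hρ : 0 < ρ) (b : ι → ℝ) :
    ρ • (primalBasic A (I k) b - xstar) = primalBasic A (I k) (ρ • (b - b₀)) := by
  rw [primalBasic_eq_add_smul hunique (isPrimalDualFeasibleBasis_of_range hI k) hρ b,
    add_sub_cancel_left, smul_smul, mul_inv_cancel₀ hρ.ne', one_smul]

lemma smul_mix_sub (hunique : optSet A c b₀ = {xstar})
    (hI : Set.range I = {J | IsPrimalDualFeasibleBasis A c b₀ J})
    {𝒦 : Finset (Fin K)} {α : 𝒦 → ℝ} (hα : ∑ k, α k = 1) {ρ : ℝ} (hρ : 0 < ρ)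
    (b : ι → ℝ) : ρ • (mix A I 𝒦 α b - xstar) = mix A I 𝒦 α (ρ • (b - b₀)) := by
  -- Weights of sum one allow `xstar` to be distributed over the terms of the mixture.
  have h1 : xstar = ∑ k : 𝒦, α k • xstar := by rw [← Finset.sum_smul, hα, one_smul]
  simp only [mix]
  conv_lhs => rw [h1, ← Finset.sum_sub_distrib, Finset.smul_sum]
  refine Finset.sum_congr rfl fun k _ => ?_
  rw [← smul_primalBasic_sub hunique hI k hρ b, ← smul_sub, smul_comm]

/-- On a common point of two cones, the two dual solutions agree. -/
lemma dualBasic_dotProduct_eq_of_mem_cones (hunique : optSet A c b₀ = {xstar})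
    (hI : Set.range I = {J | IsPrimalDualFeasibleBasis A c b₀ J})
    {j k : Fin K} {v : ι → ℝ}
    (hj : v ∈ cone A xstar (I j)) (hk : v ∈ cone A xstar (I k)) :
    (dualBasic A c (I j) - dualBasic A c (I k)) ⬝ᵥ v = 0 := by
  -- For small `ε > 0` both bases are optimal at `b₀ + ε • v` as well as at `b₀`. Their dual values
  -- agree at both points, hence on the difference.
  have ht : Tendsto (fun ε : ℝ => b₀ + ε • v) (𝓝[>] 0) (𝓝 b₀) := by
    have : Tendsto (fun ε : ℝ => b₀ + ε • v) (𝓝 0) (𝓝 (b₀ + (0 : ℝ) • v)) :=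
      Continuous.tendsto (by fun_prop) 0
    rw [zero_smul, add_zero] at this
    exact this.mono_left nhdsWithin_le_nhds
  obtain ⟨ε, hε, hpos⟩ :=
    ((ht.eventually (eventually_feasible_iff_mem_cone hunique hI)).and self_mem_nhdsWithin).exists
  have hpos : 0 < ε := hpos
  have hj0 := isPrimalDualFeasibleBasis_of_range hI j
  have hk0 := isPrimalDualFeasibleBasis_of_range hI k
  have hv : ε⁻¹ • (b₀ + ε • v - b₀) = v := by
    rw [add_sub_cancel_left, smul_smul, inv_mul_cancel₀ hpos.ne', one_smul]
  have hj' := (hε j ε⁻¹ (inv_pos.2 hpos)).2 (by rwa [hv])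
  have hk' := (hε k ε⁻¹ (inv_pos.2 hpos)).2 (by rwa [hv])
  have e := IsPrimalDualFeasibleBasis.dualBasic_dotProduct_eq (A := A) (c := c)
    ⟨hj0.1, hj'⟩ ⟨hk0.1, hk'⟩
  have e0 := hj0.dualBasic_dotProduct_eq hk0
  simp only [dotProduct_add, dotProduct_smul, smul_eq_mul] at e
  rw [sub_dotProduct]
  have : ε * (dualBasic A c (I j) ⬝ᵥ v - dualBasic A c (I k) ⬝ᵥ v) = 0 := by
    rw [mul_sub]; linarith
  exact (mul_eq_zero.1 this).resolve_left hpos.ne'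

/-- Near `b₀` and for nondegenerate right-hand sides, the set of optimal bases is nonempty and is
determined by the cell of the rescaled deviation. -/
lemma exists_feasibleExactly {ρ : ℝ} (hρ : 0 < ρ)
    (hrange : ∀ J, IsPrimalDualFeasibleBasis A c b J → ∃ k, I k = J)
    (hcone : ∀ k, ∀ ρ : ℝ, 0 < ρ →
      (0 ≤ primalBasic A (I k) b ↔ ρ • (b - b₀) ∈ cone A xstar (I k)))
    (hex : ∃ J, IsPrimalDualFeasibleBasis A c b J) :
    ∃ 𝒦 : Finset (Fin K), 𝒦.Nonempty ∧ FeasibleExactly A c I 𝒦 b ∧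
      ρ • (b - b₀) ∈ closedCell A xstar I 𝒦 := by
  classical
  refine ⟨Finset.univ.filter fun k => 0 ≤ primalBasic A (I k) b, ?_, ?_, ?_, ?_⟩
  · obtain ⟨J, hJ⟩ := hex
    obtain ⟨k, rfl⟩ := hrange J hJ
    exact ⟨k, by simpa using hJ.2⟩
  · intro J hJ
    constructor
    · intro h
      obtain ⟨k, rfl⟩ := hrange J ⟨hJ, h⟩
      exact ⟨k, by simpa using h, rfl⟩
    · rintro ⟨k, hk, rfl⟩
      simpa using hk
  · intro k hk
    exact (hcone k ρ hρ).1 (by simpa using hk)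
  · intro k hk
    have hk' : ρ • (b - b₀) ∉ cone A xstar (I k) := fun h => by
      have := (hcone k ρ hρ).2 h
      simp [this] at hk
    simp only [cone, Set.mem_ofPred_eq, not_forall, not_le] at hk'
    obtain ⟨j, hj, h0, hlt⟩ := hk'
    exact ⟨j, hj, h0, hlt.le⟩

end LP

namespace OT

/-- Conjunction of a local event and of the avoidance of a null closed set. -/
lemma tendsto_measure_not_good {Ω Ω' : Type*} {mΩ : MeasurableSpace Ω} {mΩ' : MeasurableSpace Ω'}
    {μ : Measure Ω} [IsProbabilityMeasure μ] {ν : Measure Ω'} [IsProbabilityMeasure ν]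
    {ι : Type*} [Fintype ι] {b : ℕ → Ω → ι → ℝ} {b₀ : ι → ℝ}
    {ρ : ℕ → ℝ} (hρ : Tendsto ρ atTop atTop) (hρpos : ∀ t, 0 < ρ t) {Z : Ω' → ι → ℝ}
    (h : TendstoInDistribution (fun t ω => ρ t • (b t ω - b₀)) atTop Z (fun _ => μ) ν)
    {p : (ι → ℝ) → Prop} (hp : ∀ᶠ x in 𝓝 b₀, p x) {B : Set (ι → ℝ)} (hB : IsClosed B)
    (hB0 : ∀ᵐ ω ∂ν, Z ω ∉ B) :
    Tendsto (fun t => μ {ω | ¬ (p (b t ω) ∧ ρ t • (b t ω - b₀) ∉ B)}) atTop (𝓝 0) := by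
  have h1 := tendsto_measure_notMem_nhds hρ hρpos h (U := {x | p x}) hp
  have h2 := h.tendsto_measure_closed_zero hB hB0
  have h3 := h1.add h2
  rw [add_zero] at h3
  refine tendsto_of_tendsto_of_tendsto_of_le_of_le tendsto_const_nhds h3 (fun _ => zero_le) fun t => ?_
  refine le_trans (measure_mono fun ω hω => ?_) (measure_union_le _ _)
  by_cases hpω : p (b t ω)
  · right
    by_contra hb
    exact hω ⟨hpω, hb⟩
  · exact Or.inl hpω

end OT

end

/-! ### Assembly of the two limit laws. -/

theorem theorem6p7 {N : ℕ} (c : Fin (N + 1) × Fin (N + 1) → ℝ) (r s : Fin (N + 1) → ℝ)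
    (hr : r ∈ OT.riSimplex (Fin (N + 1))) (hs : s ∈ OT.riSimplex (Fin (N + 1)))
    -- the optimal transport coupling is unique
    (πstar : Fin (N + 1) × Fin (N + 1) → ℝ)
    (hunique : LP.optSet (OT.reducedMatrix N) c (OT.reducedRhs r s) = {πstar})
    -- an enumeration without repetition of the primal and dual feasible bases
    {K : ℕ} (I : Fin K → Finset (Fin (N + 1) × Fin (N + 1))) (hIinj : Function.Injective I)
    (hI : Set.range I =
      {J | LP.IsPrimalDualFeasibleBasis (OT.reducedMatrix N) c (OT.reducedRhs r s) J})
    -- two independent i.i.d. samples, from `r` and from `s`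
    {Ω : Type*} [MeasurableSpace Ω] (μ : Measure Ω) [IsProbabilityMeasure μ]
    (X Y : ℕ → Ω → Fin (N + 1)) (hX : ∀ k, Measurable (X k)) (hY : ∀ k, Measurable (Y k))
    (hXlaw : ∀ k i, μ.real (X k ⁻¹' {i}) = r i) (hYlaw : ∀ k i, μ.real (Y k ⁻¹' {i}) = s i)
    (hindep : iIndepFun (Sum.elim X Y) μ)
    -- sample sizes, growing with limiting proportion `lam`
    (n m : ℕ → ℕ) (hnpos : ∀ t, 0 < n t) (hmpos : ∀ t, 0 < m t)
    (hn : Tendsto n atTop atTop) (hm : Tendsto m atTop atTop)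
    (lam : ℝ) (hlam : lam ∈ Set.Ioo (0 : ℝ) 1)
    (hratio : Tendsto (fun t => (m t : ℝ) / (n t + m t)) atTop (𝓝 lam))
    -- any measurable choice of the empirical optimal coupling
    (πhat : ℕ → Ω → Fin (N + 1) × Fin (N + 1) → ℝ) (hπmeas : ∀ t, AEMeasurable (πhat t) μ)
    (hπhat : ∀ t ω, πhat t ω ∈ LP.optSet (OT.reducedMatrix N) c
      (OT.reducedRhs (OT.empirical X (n t) ω) (OT.empirical Y (m t) ω)))
    -- independent Gaussian vectors
    {Ω' : Type*} [MeasurableSpace Ω'] (ν : Measure Ω') [IsProbabilityMeasure ν]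
    (G₁ : Ω' → EuclideanSpace ℝ (Fin N)) (G₂ : Ω' → EuclideanSpace ℝ (Fin (N + 1)))
    (hG₁ : HasLaw G₁ (OT.gaussianLimit (OT.dagger r)) ν) (hG₂ : HasLaw G₂ (OT.gaussianLimit s) ν)
    (hG : IndepFun G₁ G₂ ν) :
    -- the general limit law
    (∀ (α : ℕ → (𝒦 : Finset (Fin K)) → Ω → (𝒦 → ℝ))
        (αlim : (𝒦 : Finset (Fin K)) → Ω' → (𝒦 → ℝ)),
      -- the weights lie in the simplex and represent the empirical coupling
      (∀ t (𝒦 : Finset (Fin K)), 𝒦.Nonempty → ∀ ω, α t 𝒦 ω ∈ stdSimplex ℝ 𝒦) →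
      (∀ 𝒦 : Finset (Fin K), 𝒦.Nonempty → ∀ ω, αlim 𝒦 ω ∈ stdSimplex ℝ 𝒦) →
      (∀ t (𝒦 : Finset (Fin K)), 𝒦.Nonempty → ∀ ω,
        LP.FeasibleExactly (OT.reducedMatrix N) c I 𝒦
          (OT.reducedRhs (OT.empirical X (n t) ω) (OT.empirical Y (m t) ω)) →
        πhat t ω = LP.mix (OT.reducedMatrix N) I 𝒦 (α t 𝒦 ω)
          (OT.reducedRhs (OT.empirical X (n t) ω) (OT.empirical Y (m t) ω))) →
      -- for each `𝒦`, weights and rescaled marginals converge jointly in distribution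
      (∀ 𝒦 : Finset (Fin K), 𝒦.Nonempty → TendstoInDistribution
        (fun t ω => (α t 𝒦 ω, OT.rate (n t) (m t) •
          (OT.reducedRhs (OT.empirical X (n t) ω) (OT.empirical Y (m t) ω)
            - OT.reducedRhs r s)))
        atTop (fun ω => (αlim 𝒦 ω, OT.gaussPair lam (G₁ ω) (G₂ ω))) (fun _ => μ) ν) →
      TendstoInDistribution (fun t ω => OT.rate (n t) (m t) • (πhat t ω - πstar)) atTop
        (fun ω => LP.limitMap (OT.reducedMatrix N) πstar I (fun 𝒦 => αlim 𝒦 ω)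
          (OT.gaussPair lam (G₁ ω) (G₂ ω))) (fun _ => μ) ν) ∧
    -- the simplified limit law when the dual basic solutions are pairwise distinct
    ((∀ j k, j < k → LP.dualBasic (OT.reducedMatrix N) c (I j) ≠
        LP.dualBasic (OT.reducedMatrix N) c (I k)) →
      TendstoInDistribution (fun t ω => OT.rate (n t) (m t) • (πhat t ω - πstar)) atTop
        (fun ω => LP.limitMapSingle (OT.reducedMatrix N) πstar I
          (OT.gaussPair lam (G₁ ω) (G₂ ω))) (fun _ => μ) ν) := by
  classical
  have hbasis : ∀ k, LP.IsBasis (OT.reducedMatrix N) (I k) := fun k =>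
    (LP.isPrimalDualFeasibleBasis_of_range hI k).1.1
  have hρ := OT.tendsto_rate hn hlam hratio
  have hρpos : ∀ t, 0 < OT.rate (n t) (m t) := fun t => by
    have h1 := hnpos t
    have h2 := hmpos t
    unfold OT.rate
    positivity
  have hclt := OT.tendstoInDistribution_rate_smul hr hs hX hY hXlaw hYlaw hindep hnpos hmpos hn hm
    hlam hratio hG₁ hG₂ hG
  have hGm := OT.aemeasurable_gaussPair (lam := lam) hG₁.aemeasurable hG₂.aemeasurable
  have hWm : ∀ t, AEMeasurable (fun ω => OT.rate (n t) (m t) • (πhat t ω - πstar)) μ := fun t =>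
    ((hπmeas t).sub_const πstar).const_smul (OT.rate (n t) (m t))
  set b : ℕ → Ω → Fin N ⊕ Fin (N + 1) → ℝ := fun t ω =>
    OT.reducedRhs (OT.empirical X (n t) ω) (OT.empirical Y (m t) ω) with hb
  set b₀ := OT.reducedRhs r s with hb₀
  set G : Ω' → Fin N ⊕ Fin (N + 1) → ℝ := fun ω => OT.gaussPair lam (G₁ ω) (G₂ ω) with hGdef
  have hlocal := (LP.eventually_mem_range_of_feasible hI).and
    ((LP.eventually_feasible_iff_mem_cone hunique hI).and
      (LP.eventually_nondegenerate (OT.reducedMatrix N) b₀))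
  -- the degenerate directions
  set B : Set (Fin N ⊕ Fin (N + 1) → ℝ) :=
    ⋃ T ∈ {T : Finset (Fin (N + 1) × Fin (N + 1)) |
      T.card < Fintype.card (Fin N ⊕ Fin (N + 1)) ∧ b₀ ∈ LP.colSpan (OT.reducedMatrix N) T},
      (LP.colSpan (OT.reducedMatrix N) T : Set (Fin N ⊕ Fin (N + 1) → ℝ)) with hBdef
  have hBc : IsClosed B := (Set.toFinite _).isClosed_biUnion fun T _ =>
    Submodule.closed_of_finiteDimensional _
  have hB0 : ∀ᵐ ω ∂ν, G ω ∉ B := by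
    have : ∀ T : Finset (Fin (N + 1) × Fin (N + 1)), ∀ᵐ ω ∂ν,
        T.card < Fintype.card (Fin N ⊕ Fin (N + 1)) ∧ b₀ ∈ LP.colSpan (OT.reducedMatrix N) T →
        G ω ∉ LP.colSpan (OT.reducedMatrix N) T := by
      intro T
      by_cases hT : T.card < Fintype.card (Fin N ⊕ Fin (N + 1)) ∧
          b₀ ∈ LP.colSpan (OT.reducedMatrix N) T
      · filter_upwards [OT.ae_gaussPair_notMem_submodule hr hs hlam hG₁ hG₂ hG
          (LP.colSpan_ne_top hT.1) hT.2] with ω h _ using h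
      · exact ae_of_all _ fun _ h => absurd h hT
    filter_upwards [ae_all_iff.2 this] with ω h hmem
    simp only [hBdef, Set.mem_iUnion] at hmem
    obtain ⟨T, hT, hm⟩ := hmem
    exact h T hT hm
  have hnondeg : ∀ t ω, (∀ ρ : ℝ, (∀ T : Finset (Fin (N + 1) × Fin (N + 1)),
      T.card < Fintype.card (Fin N ⊕ Fin (N + 1)) → b₀ ∈ LP.colSpan (OT.reducedMatrix N) T →
      ρ • (b t ω - b₀) ∉ LP.colSpan (OT.reducedMatrix N) T) →
      LP.Nondegenerate (OT.reducedMatrix N) (b t ω)) →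
      OT.rate (n t) (m t) • (b t ω - b₀) ∉ B → LP.Nondegenerate (OT.reducedMatrix N) (b t ω) := by
    intro t ω h hB
    refine h (OT.rate (n t) (m t)) fun T hT hT0 hmem => hB ?_
    simp only [hBdef, Set.mem_iUnion]
    exact ⟨T, ⟨hT, hT0⟩, hmem⟩
  refine ⟨fun α αlim hα _ hrep hconv => ?_, fun hne => ?_⟩
  -- The functional `π(I_k, ·)_j` takes the value `πstar j = 0` at `b₀`, so `G` almost surely avoids
  -- every face of the cones; closed cells and cells then agree at `G`.
  · have hface : ∀ᵐ ω ∂ν, ∀ k, ∀ j ∈ I k, πstar j = 0 →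
        LP.primalBasic (OT.reducedMatrix N) (I k) (G ω) j ≠ 0 := by
      refine ae_all_iff.2 fun k => ae_all_iff.2 fun j => ?_
      by_cases h : j ∈ I k ∧ πstar j = 0
      · have h0 : (LinearMap.proj j ∘ₗ LP.primalBasicLin (hbasis k)) b₀ = (0 : ℝ) := by
          rw [LinearMap.comp_apply, LP.primalBasicLin_apply, LP.primalBasic_eq_of_unique hunique
            (LP.isPrimalDualFeasibleBasis_of_range hI k)]
          exact h.2
        filter_upwards [OT.ae_linearMap_gaussPair_ne_zero hr hs hlam hG₁ hG₂ hG
          ((hbasis k).proj_comp_primalBasicLin_ne_zero h.1) h0] with ω hω _ _ using hω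
      · exact ae_of_all _ fun _ h1 h2 => absurd ⟨h1, h2⟩ h
    refine tendstoInDistribution_of_closed_pieces
      (J := {𝒦 : Finset (Fin K) // 𝒦.Nonempty})
      (E := fun 𝒦 => (𝒦.1 → ℝ) × (Fin N ⊕ Fin (N + 1) → ℝ))
      (Z := fun 𝒦 t ω => (α t 𝒦.1 ω, OT.rate (n t) (m t) • (b t ω - b₀)))
      (Z' := fun 𝒦 ω => (αlim 𝒦.1 ω, G ω)) (fun 𝒦 => hconv 𝒦.1 𝒦.2)
      (fun 𝒦 => Prod.snd ⁻¹' LP.closedCell (OT.reducedMatrix N) πstar I 𝒦.1)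
      (fun 𝒦 => (LP.isClosed_closedCell hbasis πstar 𝒦.1).preimage continuous_snd)
      (fun 𝒦 z => LP.mix (OT.reducedMatrix N) I 𝒦.1 z.1 z.2)
      (fun 𝒦 => LP.continuous_mix hbasis 𝒦.1) hWm
      (LP.aemeasurable_limitMap hbasis πstar
        (fun 𝒦 h𝒦 => (hconv 𝒦 h𝒦).aemeasurable_limit.fst) hGm) ?_ ?_ ?_
    -- The bad event lies in the event that `b` is not local or `v` meets `B`. Outside it some basis
    -- is optimal, so the set `𝒦` of feasible ones is nonempty and the representation by weights
    -- applies.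
    · refine tendsto_of_tendsto_of_tendsto_of_le_of_le tendsto_const_nhds
        (OT.tendsto_measure_not_good hρ hρpos hclt hlocal hBc hB0) (fun _ => zero_le) fun t => ?_
      refine measure_mono fun ω hbad hgood => hbad ?_
      obtain ⟨⟨hrange, hcone, hnd⟩, hnB⟩ := hgood
      obtain ⟨𝒦, h𝒦, hexact, hcell⟩ := LP.exists_feasibleExactly (hρpos t) hrange hcone
        ((hnondeg t ω hnd hnB).exists_isPrimalDualFeasibleBasis (OT.isCompact_optSet c _)
          ⟨_, hπhat t ω⟩)
      refine ⟨⟨𝒦, h𝒦⟩, hcell, ?_⟩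
      rw [hrep t 𝒦 h𝒦 ω hexact]
      exact LP.smul_mix_sub hunique hI (hα t 𝒦 h𝒦 ω).2 (hρpos t) _
    · filter_upwards [hface] with ω hω 𝒦 hmem
      exact LP.limitMap_eq_mix _ 𝒦.2 (LP.mem_coneCell_of_mem_closedCell hω hmem)
    · filter_upwards [hface] with ω hω 𝒦 𝒦' hmem hmem'
      exact Subtype.ext (LP.coneCell_unique (LP.mem_coneCell_of_mem_closedCell hω hmem)
        (LP.mem_coneCell_of_mem_closedCell hω hmem'))
  · have hne' : ∀ j k, j ≠ k → LP.dualBasic (OT.reducedMatrix N) c (I j) -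
        LP.dualBasic (OT.reducedMatrix N) c (I k) ≠ 0 := by
      intro j k hjk h
      rcases lt_or_gt_of_ne hjk with hlt | hlt
      · exact hne j k hlt (sub_eq_zero.1 h)
      · exact hne k j hlt (sub_eq_zero.1 h).symm
    -- the directions in which two dual solutions agree
    set D : Set (Fin N ⊕ Fin (N + 1) → ℝ) := ⋃ p ∈ {p : Fin K × Fin K | p.1 ≠ p.2},
      {v | (LP.dualBasic (OT.reducedMatrix N) c (I p.1) -
        LP.dualBasic (OT.reducedMatrix N) c (I p.2)) ⬝ᵥ v = 0} with hDdef
    have hDc : IsClosed D := (Set.toFinite _).isClosed_biUnion fun p _ =>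
      isClosed_eq (by fun_prop) continuous_const
    have hD0 : ∀ᵐ ω ∂ν, G ω ∉ D := by
      have : ∀ p : Fin K × Fin K, ∀ᵐ ω ∂ν, p.1 ≠ p.2 →
          (LP.dualBasic (OT.reducedMatrix N) c (I p.1) -
            LP.dualBasic (OT.reducedMatrix N) c (I p.2)) ⬝ᵥ G ω ≠ 0 := by
        intro p
        by_cases hp : p.1 ≠ p.2
        · set u := LP.dualBasic (OT.reducedMatrix N) c (I p.1) -
            LP.dualBasic (OT.reducedMatrix N) c (I p.2) with hu
          have hf : dotProductBilin ℝ ℝ u ≠ 0 := by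
            intro h
            exact hne' _ _ hp (dotProduct_self_eq_zero.1 (LinearMap.congr_fun h u))
          -- Both bases are optimal at `b₀`, so their dual values there coincide.
          have h0 : dotProductBilin ℝ ℝ u b₀ = 0 := by
            change u ⬝ᵥ b₀ = 0
            rw [hu, sub_dotProduct, (LP.isPrimalDualFeasibleBasis_of_range hI p.1
              ).dualBasic_dotProduct_eq (LP.isPrimalDualFeasibleBasis_of_range hI p.2), sub_self]
          filter_upwards [OT.ae_linearMap_gaussPair_ne_zero hr hs hlam hG₁ hG₂ hG hf h0]
            with ω hω _ using hω
        · exact ae_of_all _ fun _ h => absurd h hp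
      filter_upwards [ae_all_iff.2 this] with ω h hmem
      simp only [hDdef, Set.mem_iUnion] at hmem
      obtain ⟨p, hp, hm⟩ := hmem
      exact h p hp hm
    have huniq : ∀ v, v ∉ D → ∀ j k, v ∈ LP.cone (OT.reducedMatrix N) πstar (I j) →
        v ∈ LP.cone (OT.reducedMatrix N) πstar (I k) → j = k := by
      intro v hv j k hj hk
      by_contra hjk
      refine hv ?_
      simp only [hDdef, Set.mem_iUnion]
      exact ⟨(j, k), hjk, LP.dualBasic_dotProduct_eq_of_mem_cones hunique hI hj hk⟩
    refine tendstoInDistribution_of_closed_pieces (J := Fin K)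
      (E := fun _ => Fin N ⊕ Fin (N + 1) → ℝ)
      (Z := fun _ t ω => OT.rate (n t) (m t) • (b t ω - b₀)) (Z' := fun _ => G) (fun _ => hclt)
      (fun k => LP.cone (OT.reducedMatrix N) πstar (I k))
      (fun k => LP.isClosed_cone (hbasis k) πstar)
      (fun k v => LP.primalBasic (OT.reducedMatrix N) (I k) v)
      (fun k => (hbasis k).continuous_primalBasic) hWm
      ((LP.measurable_limitMapSingle hbasis πstar).comp_aemeasurable hGm) ?_ ?_ ?_
    · refine tendsto_of_tendsto_of_tendsto_of_le_of_le tendsto_const_nhds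
        (OT.tendsto_measure_not_good (B := B ∪ D) hρ hρpos hclt hlocal (hBc.union hDc)
          (by filter_upwards [hB0, hD0] with ω h1 h2 h using h.elim h1 h2))
        (fun _ => zero_le) fun t => ?_
      refine measure_mono fun ω hbad hgood => hbad ?_
      obtain ⟨⟨hrange, hcone, hnd⟩, hnBD⟩ := hgood
      have hnondeg' := hnondeg t ω hnd fun h => hnBD (Or.inl h)
      obtain ⟨J, hJ⟩ := hnondeg'.exists_isPrimalDualFeasibleBasis (OT.isCompact_optSet c _)
        ⟨_, hπhat t ω⟩
      obtain ⟨k, rfl⟩ := hrange J hJ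
      have hk := (hcone k _ (hρpos t)).1 hJ.2
      refine ⟨k, hk, ?_⟩
      -- Off `D` no second cone contains the deviation, so `I k` is the only optimal basis and
      -- leaves the empirical coupling no choice; this replaces the weights.
      have heq : πhat t ω = LP.primalBasic (OT.reducedMatrix N) (I k) (b t ω) := by
        refine hnondeg'.eq_primalBasic_of_unique (OT.isCompact_optSet c _) (fun J' hJ' => ?_)
          (hπhat t ω)
        obtain ⟨k', rfl⟩ := hrange J' hJ'
        rw [huniq _ (fun h => hnBD (Or.inr h)) k' k ((hcone k' _ (hρpos t)).1 hJ'.2) hk]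
      rw [heq]
      exact LP.smul_primalBasic_sub hunique hI k (hρpos t) _
    · filter_upwards [hD0] with ω hω k hk
      exact LP.limitMapSingle_eq_primalBasic hk fun j hj => huniq _ hω j k hj hk
    · filter_upwards [hD0] with ω hω j k hj hk
      exact huniq _ hω j k hj hk
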